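/- **Setting.** Let $\mathcal A$ be a mechanism space with distance $d_{\mathcal A}$, $\mathcal B$ a finite set of agent behaviours, $\mathcal H$ a finite set of signals, $\mathcal U$ a measurable space of users with a probability law, $\mathrm{sig}:\mathcal A\times\mathcal B\times\mathcal U\to\mathcal H$, $\hat M=(\hat M_h)_{h\in\mathcal H}$ a (learned) family of transition matrices on $\mathcal B$, and $L:\mathcal A\times\mathcal B\times\mathcal U\to[-K,0]$ a loss, $K>0$ ($\mathrm{sig}$ and $L$ measurable in $(b,u)$). Users $u_1,u_2,\dots$ are i.i.d.; for every mechanism $a$ the behaviours $b^a_1,b^a_2,\dots$ are generated by $P(b^a_{t+1}=b'\mid b^a_1,u_1,\dots,b^a_t,u_t)=\hat M_{\mathrm{sig}(a,b^a_t,u_t)}(b^a_t,b')$, with $u_{t+1}$ independent of $(b^a_1,u_1,\dots,b^a_t,u_t,b^a_{t+1})$, and the Markov chain $(b^a_t,u_t)_{t\ge1}$ is stationary with stationary distribution $\pi_a$. Put $\mathcal R(a,\hat M)=E_{\pi_a}L(a,b,u)$. Let $\delta>0$ and let $N=\mathcal N_{d_{\mathcal A}}(\delta,\mathcal A)$ (finite)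 be the smallest number of closed $\delta$-balls with centres in $\mathcal A$ that cover $\mathcal A$, $g_1,\dots,g_N$ the centres of such a smallest cover, and $\mathcal A=\bigcup_{i\le N}\mathcal A_i^\delta$ a partition with $d_{\mathcal A}(a,g_i)\le\delta$ for $a\in\mathcal A_i^\delta$. In $\delta$-sample sharing, all $a\in\mathcal A_i^\delta$ use the behaviour data of $s(a,\delta)=g_i$: $$\mathcal R_{T}(a,\hat M,\delta)=\frac1{T}\sum_{t=1}^{T}L\big(a,b_t^{s(a,\delta)},u_t\big).$$ For a class $F$ of functions on $\mathcal B\times\mathcal U$, $\mathcal N_1(r,F,T)$ is the maximum, over all samples $x\in(\mathcal B\times\mathcal U)^T$, of the smallest cardinality of an $r$-cover (with centres in the set) of $\{(f(x_1),\dots,f(x_T)):f\in F\}$ for the distance $\frac1T\sum_t|v_t-w_t|$; and $L\circ\mathcal A_i^\delta=\{L(a,\cdot,\cdot):a\in\mathcal A_i^\delta\}$. These classes are assumed measurable in the usual sense of empirical process theory: suprema over the class of absolute values of weighted sums over a sample are universally measurable. The total variation distance is $d_{TV}(\mu,\nu)=\sup_C|\mu(C)-\nu(C)|$, and the $\beta$-mixing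 coefficient $\beta(a,m)$ is the supremum over $t\ge 1$ of the total variation distance between the joint law of $(X_1,\dots,X_t)$ and $(X_{t+m},X_{t+m+1},\dots)$ and the product of their laws, where $X_t=(b^a_t,u_t)$. **Theorem.** Suppose that $d_{TV}(\pi_a,\pi_{a'})\le\alpha\,d_{\mathcal A}(a,a')$ for all $a,a'\in\mathcal A$ (with $\alpha\ge0$), and that $\beta(a,m)\le\beta_0m^{-\gamma}$ for all $a\in\mathcal A$ and all integers $m\ge1$, where $\beta_0,\gamma\ge0$. Let $\varepsilon>0$, $\delta>0$ with $K\alpha\delta<\varepsilon$, and $0<s<\gamma$. Then for every $T_2\ge1$ $$P\Big(\sup_{a\in\mathcal A}\big|\mathcal R_{T_2}(a,\hat M,\delta)-\mathcal R(a,\hat M)\big|\ge\varepsilon\Big)\le N\max_{1\le i\le N}\Big(16\,\mathcal N_1\big(\tfrac{\varepsilon-K\alpha\delta}{16},L\circ\mathcal A_i^\delta,T_2\big)\exp\Big(-\frac{(\varepsilon-\delta\alpha K)^2}{128K^2}\Big\lceil\frac{T_2^{s/(1+s)}}2\Big\rceil\Big)+\beta_0\Big\lceil T_2^{\frac{s-\gamma}{1+s}}\Big\rceil\Big),$$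 and the same bound holds with $\beta_0T_2^{\frac{s-\gamma}{1+s}}$ in place of $\beta_0\lceil T_2^{\frac{s-\gamma}{1+s}}\rceil$. In particular there are constants $C,c>0$, independent of $T_2$, such that for every $T_2\ge1$ this probability is at most $$C\,N\Big(\max_{1\le i\le N}\mathcal N_1\big(\tfrac{\varepsilon-K\alpha\delta}{16},L\circ\mathcal A_i^\delta,T_2\big)\,e^{-c\,T_2^{s/(1+s)}}+T_2^{\frac{s-\gamma}{1+s}}\Big).$$ -/

import Mathlib

open MeasureTheory ProbabilityTheory
open scoped NNReal ENNReal

noncomputable section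

/-- Total variation distance `sup_C |μ C - ν C|` over measurable sets (a number in `[0, 1]` for
probability measures). -/
def tvDist {S : Type*} [MeasurableSpace S] (μ ν : Measure S) : ℝ :=
  ⨆ C : {C : Set S // MeasurableSet C}, |μ.real C.1 - ν.real C.1|

/-- The `β`-mixing coefficient at lag `m` of a process `X 0, X 1, …`: the supremum over `t` of the
total variation distance between the joint law of the past `(X 0, …, X t)` and the future
`(X (t + m), X (t + m + 1), …)`, and the product of their two laws. -/
def betaMixing {Ω S : Type*} [MeasurableSpace Ω] [MeasurableSpace S] (P : Measure Ω)
    (X : ℕ → Ω → S) (m : ℕ) : ℝ :=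
  ⨆ t : ℕ, tvDist
    (P.map fun ω => ((fun i : Fin (t + 1) => X i ω), (fun j : ℕ => X (t + m + j) ω)))
    ((P.map fun ω => fun i : Fin (t + 1) => X i ω).prod
      (P.map fun ω => fun j : ℕ => X (t + m + j) ω))

/-- `X 0, X 1, …` is a time-homogeneous Markov chain with transition kernel `κ`: for every `t`,
the conditional law of `X (t + 1)` given `(X 0, …, X t)` is `κ (X t)`. -/
def IsMarkovChain {Ω S : Type*} [MeasurableSpace Ω] [MeasurableSpace S] (P : Measure Ω)
    (κ : Kernel S S) (X : ℕ → Ω → S) : Prop :=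
  ∀ t : ℕ, P.map (fun ω => ((fun i : Fin (t + 1) => X i ω), X (t + 1) ω)) =
    (P.map fun ω => fun i : Fin (t + 1) => X i ω) ⊗ₘ
      κ.comap (fun h : Fin (t + 1) → S => h (Fin.last t)) (measurable_pi_apply _)

/-- The uniform covering number `N₁(r, F, T)` of a class `F` of real functions: the maximum, over
all samples `x` of `T` points, of the cardinality of a smallest `r`-cover of the restriction
`F|ₓ ⊆ ℝ^T` for the normalised `ℓ¹` distance `(1/T) ∑ₜ |vₜ - wₜ|` (a cover of radius `T * r` for
the unnormalised one, which is the distance of `PiLp 1`). -/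
def coveringNumberL1 {X : Type*} (r : ℝ≥0) (F : Set (X → ℝ)) (T : ℕ) : ℕ∞ :=
  ⨆ x : Fin T → X, Metric.coveringNumber (T * r)
    ((fun f : X → ℝ => (WithLp.toLp 1 fun t => f (x t) : PiLp 1 fun _ : Fin T => ℝ)) '' F)

/-- The usual measurability requirement on a class of functions in empirical process theory:
suprema over the class of absolute values of weighted sums over a sample are universally
measurable functions of the sample. It holds for instance for countable classes of measurable
functions. -/
def IsMeasurableClass {X : Type*} [MeasurableSpace X] (F : Set (X → ℝ)) : Prop :=
  ∀ (n : ℕ) (w : Fin n → ℝ) (Q : Measure (Fin n → X)), IsProbabilityMeasure Q →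
    AEMeasurable (fun x => ⨆ f : F, |∑ t, w t * f.1 (x t)|) Q

/-- The ingredients of mechanism learning with mechanism space `A`, agent behaviours `B`, users
`U` and signals `H`. -/
structure GTML (A B U H : Type*) [MeasurableSpace B] [MeasurableSpace U] [MeasurableSpace H] where
  /-- the signal `sig(a, b, u)` sent to the agents -/
  sig : A → B → U → H
  measurable_sig : ∀ a, Measurable fun x : B × U => sig a x.1 x.2
  /-- the (learned) behaviour model: `model h b` is the law of the next behaviour profile when the
  signal is `h` and the current behaviour profile is `b` -/
  model : H → B → PMF B
  /-- the law of a user -/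
  userLaw : Measure U
  isProbabilityMeasure_userLaw : IsProbabilityMeasure userLaw
  /-- the bound on the loss -/
  K : ℝ
  K_pos : 0 < K
  /-- the loss `L(a, b, u)` -/
  loss : A → B → U → ℝ
  measurable_loss : ∀ a, Measurable fun x : B × U => loss a x.1 x.2
  loss_mem : ∀ a b u, loss a b u ∈ Set.Icc (-K) 0

namespace GTML

variable {A B U H Ω : Type*} [MeasurableSpace B] [MeasurableSpace U] [MeasurableSpace H]

/-- The transition kernel of `(bₜ, uₜ)` under mechanism `a`: from `(b, u)`, the next behaviour has
law `model (sig a b u) b` and the next user is independent of it with law `userLaw`. -/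
def kernel [Finite B] [MeasurableSingletonClass B] [Finite H] [MeasurableSingletonClass H]
    (G : GTML A B U H) (a : A) : Kernel (B × U) (B × U) :=
  ((Kernel.ofFunOfCountable fun y : H × B => (G.model y.1 y.2).toMeasure).comap
    (fun x : B × U => (G.sig a x.1 x.2, x.1)) ((G.measurable_sig a).prodMk measurable_fst)) ×ₖ
    Kernel.const (B × U) G.userLaw

/-- The data of the learning process: user data `u t`, common to all mechanisms, and for every
mechanism `a` behaviour data `b a t` generated sequentially with the behaviour model, such that
`(b a t, u t)` is a stationary Markov chain with stationary distribution `π a`. Nothing is required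
about the joint law of the behaviour data of different mechanisms. -/
structure IsStationaryData [Finite B] [MeasurableSingletonClass B] [Finite H]
    [MeasurableSingletonClass H] [MeasurableSpace Ω] (G : GTML A B U H) (P : Measure Ω)
    (u : ℕ → Ω → U) (b : A → ℕ → Ω → B) (π : A → Measure (B × U)) : Prop where
  measurable_user : ∀ t, Measurable (u t)
  measurable_behavior : ∀ a t, Measurable (b a t)
  invariant : ∀ a, (G.kernel a).Invariant (π a)
  initial : ∀ a, P.map (fun ω => (b a 0 ω, u 0 ω)) = π a
  markov : ∀ a, IsMarkovChain P (G.kernel a) fun t ω => (b a t ω, u t ω)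

/-- The expected risk of the mechanism `a`. -/
def risk (G : GTML A B U H) (π : A → Measure (B × U)) (a : A) : ℝ :=
  ∫ x, G.loss a x.1 x.2 ∂(π a)

/-- The empirical risk of the mechanism `a` on `T` data points when the behaviour data of the
mechanism `s a` are used for `a`. -/
def empiricalRisk (G : GTML A B U H) (u : ℕ → Ω → U) (b : A → ℕ → Ω → B) (s : A → A) (T : ℕ)
    (a : A) (ω : Ω) : ℝ :=
  (1 / (T : ℝ)) * ∑ t ∈ Finset.range T, G.loss a (b (s a) t ω) (u t ω)

/-- The uniform deviation between empirical risk (with sample sharing `s`) and expected risk. -/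
def uniformDeviation (G : GTML A B U H) (π : A → Measure (B × U)) (u : ℕ → Ω → U)
    (b : A → ℕ → Ω → B) (s : A → A) (T : ℕ) (ω : Ω) : ℝ :=
  ⨆ a, |G.empiricalRisk u b s T a ω - G.risk π a|

/-- The class `L ∘ A'` of the loss functions of the mechanisms in `A'`. -/
def lossClass (G : GTML A B U H) (A' : Set A) : Set (B × U → ℝ) :=
  (fun a (x : B × U) => G.loss a x.1 x.2) '' A'

end GTML

/-- `g 0, …, g (N - 1)` is a smallest `δ`-cover of the space `A`, and `a ↦ cell a` is a partition of
`A` into cells `cell ⁻¹' {i}` contained in the closed `δ`-balls around the `g i`. In the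
corresponding `δ`-sample sharing, every mechanism `a` uses the sample of `s a = g (cell a)`. -/
structure IsMinimalCoverPartition {A : Type*} [PseudoMetricSpace A] (δ : ℝ) {N : ℕ}
    (g : Fin N → A) (cell : A → Fin N) : Prop where
  card_eq : (N : ℕ∞) = Metric.coveringNumber δ.toNNReal (Set.univ : Set A)
  dist_le : ∀ a, dist a (g (cell a)) ≤ δ

end

/-!
The proof is the method of independent blocks combined with symmetrization.

*Reduction to one cell.* If the uniform deviation is at least `ε`, then some mechanism `a` deviates by
almost `ε`. Passing from the stationary distribution of `a` to that of the centre of its cell changes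
the expected risk by at most `K * α * δ` (`abs_integral_sub_le_tvDist`), so the loss of `a` deviates
by almost `ε' = ε - K * α * δ` on the data of the centre. A union bound over the cells gives the
factor `N`, and it remains to treat one stationary mixing process `X` and one class `F`.

*Independent blocks.* The sample is cut into consecutive blocks of length `a = ⌈T ^ (1 / (1 + s))⌉`.
The blocks of one parity are separated by gaps of length `a`, so making them independent costs
`betaMixing P X (a + 1)` per block (`map_blocks_le_pi_add`). There are at most `T / a` of these
costs in total, and they sum to at most `β₀ * T ^ ((s - γ) / (1 + s))`.

*Symmetrization.* For independent blocks, a ghost sample is introduced by Chebyshev's inequality,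
the blocks of the two samples are exchanged at random, and for a fixed sample Hoeffding's inequality
for Rademacher sums is applied to each member of a finite cover of the class
(`pi_exists_deviation_le`). Each parity contributes `8 * N₁`, whence the constant `16`.

*Constants.* If the asserted bound is at least `1`, there is nothing to prove. Otherwise the number
of blocks is large compared with `(K / ε') ^ 2`, which leaves room for the rounding of the block
length and of the number of blocks, and for the witness that replaces the supremum
(`exists_deviation_le_of_algebraic_mixing`). In units of `T * ε'`, the deviation `31/32` of the whole
sample leaves `31/64` for one parity; of this, `4/64` is spent on the ghost sample, `27/128` remains
for each of the two samples, `8/128` is the radius of the cover, and `18/128` is the threshold in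
Hoeffding's inequality.

*Measurability.* The events are suprema over a class and need not be measurable. Most steps hold
for outer measures. The measurability of the class is used only where the probabilities of the
symmetrized events are summed over the sign patterns (`sum_measure_le_of_card_le`).
-/

/-! ### Rademacher averages over a finite sample -/

/-- The sign `1` or `-1` encoded by a Boolean. -/
noncomputable def boolSign (b : Bool) : ℝ := if b then 1 else -1

lemma abs_boolSign (b : Bool) : |boolSign b| = 1 := by
  cases b <;> simp [boolSign]

/-- The exponential moment of a Rademacher sum is at most that of a Gaussian. -/
lemma sum_exp_boolSign_le {ι : Type*} [Fintype ι] [DecidableEq ι] (y : ι → ℝ) (l : ℝ) :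
    ∑ σ : ι → Bool, Real.exp (l * ∑ j, boolSign (σ j) * y j) ≤
      2 ^ Fintype.card ι * Real.exp (l ^ 2 * (∑ j, y j ^ 2) / 2) := by
  have h1 : ∀ σ : ι → Bool, Real.exp (l * ∑ j, boolSign (σ j) * y j) =
      ∏ j, Real.exp (l * (boolSign (σ j) * y j)) := fun σ => by
    rw [Finset.mul_sum, Real.exp_sum]
  have h2 : ∀ j, ∑ c : Bool, Real.exp (l * (boolSign c * y j)) ≤
      2 * Real.exp ((l * y j) ^ 2 / 2) := fun j => by
    have := Real.cosh_le_exp_half_sq (l * y j)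
    rw [Real.cosh_eq] at this
    simp only [Fintype.sum_bool, boolSign, if_true, one_mul, Bool.false_eq_true, if_false,
      neg_one_mul, mul_neg]
    linarith
  calc ∑ σ : ι → Bool, Real.exp (l * ∑ j, boolSign (σ j) * y j)
      = ∏ j, ∑ c : Bool, Real.exp (l * (boolSign c * y j)) := by
        rw [Fintype.prod_sum]
        exact Finset.sum_congr rfl fun σ _ => h1 σ
    _ ≤ ∏ j, (2 * Real.exp ((l * y j) ^ 2 / 2)) :=
        Finset.prod_le_prod (fun j _ => Finset.sum_nonneg fun c _ => (Real.exp_pos _).le)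
          fun j _ => h2 j
    _ = 2 ^ Fintype.card ι * Real.exp (l ^ 2 * (∑ j, y j ^ 2) / 2) := by
        rw [Finset.prod_mul_distrib, ← Real.exp_sum, Finset.prod_const, Finset.card_univ]
        congr 2
        rw [Finset.mul_sum, Finset.sum_div]
        exact Finset.sum_congr rfl fun j _ => by ring

/-- Hoeffding's inequality for Rademacher sums, one-sided, in counting form. -/
lemma card_le_rademacher_sum {ι : Type*} [Fintype ι] [DecidableEq ι] (y : ι → ℝ) {V θ : ℝ}
    (hV : 0 < V) (hy : ∑ j, y j ^ 2 ≤ V) (hθ : 0 ≤ θ) :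
    ((Finset.univ.filter fun σ : ι → Bool => θ ≤ ∑ j, boolSign (σ j) * y j).card : ℝ) ≤
      2 ^ Fintype.card ι * Real.exp (-(θ ^ 2 / (2 * V))) := by
  set s := Finset.univ.filter fun σ : ι → Bool => θ ≤ ∑ j, boolSign (σ j) * y j
  have h1 : (s.card : ℝ) * Real.exp (θ / V * θ) ≤
      2 ^ Fintype.card ι * Real.exp ((θ / V) ^ 2 * V / 2) := by
    calc (s.card : ℝ) * Real.exp (θ / V * θ) = ∑ _σ ∈ s, Real.exp (θ / V * θ) := by
          rw [Finset.sum_const, nsmul_eq_mul]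
      _ ≤ ∑ σ ∈ s, Real.exp (θ / V * ∑ j, boolSign (σ j) * y j) := by
          refine Finset.sum_le_sum fun σ hσ => Real.exp_le_exp.2 ?_
          exact mul_le_mul_of_nonneg_left (Finset.mem_filter.1 hσ).2 (by positivity)
      _ ≤ ∑ σ : ι → Bool, Real.exp (θ / V * ∑ j, boolSign (σ j) * y j) :=
          Finset.sum_le_univ_sum_of_nonneg fun σ => (Real.exp_pos _).le
      _ ≤ _ := sum_exp_boolSign_le y _
      _ ≤ _ := by gcongr
  have h2 : Real.exp (-(θ ^ 2 / (2 * V))) =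
      Real.exp ((θ / V) ^ 2 * V / 2) / Real.exp (θ / V * θ) := by
    rw [← Real.exp_sub]
    congr 1
    field_simp
    ring
  rw [h2, ← mul_div_assoc, le_div_iff₀ (Real.exp_pos _)]
  exact h1

/-- Hoeffding's inequality for Rademacher sums, in counting form. -/
lemma card_le_abs_rademacher_sum {ι : Type*} [Fintype ι] [DecidableEq ι] (y : ι → ℝ) {V θ : ℝ}
    (hV : 0 < V) (hy : ∑ j, y j ^ 2 ≤ V) (hθ : 0 ≤ θ) :
    ((Finset.univ.filter fun σ : ι → Bool => θ ≤ |∑ j, boolSign (σ j) * y j|).card : ℝ) ≤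
      2 ^ Fintype.card ι * (2 * Real.exp (-(θ ^ 2 / (2 * V)))) := by
  have h1 := card_le_rademacher_sum y hV hy hθ
  have h2 := card_le_rademacher_sum (fun j => - y j) hV (by simpa using hy) hθ
  have h3 : (Finset.univ.filter fun σ : ι → Bool => θ ≤ |∑ j, boolSign (σ j) * y j|) ⊆
      (Finset.univ.filter fun σ : ι → Bool => θ ≤ ∑ j, boolSign (σ j) * y j) ∪
      (Finset.univ.filter fun σ : ι → Bool => θ ≤ ∑ j, boolSign (σ j) * (- y j)) := by
    intro σ hσ
    simpa [le_abs, Finset.sum_neg_distrib] using hσ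
  have h4 : ((Finset.univ.filter fun σ : ι → Bool =>
      θ ≤ |∑ j, boolSign (σ j) * y j|).card : ℝ) ≤ _ :=
    Nat.cast_le.2 ((Finset.card_le_card h3).trans (Finset.card_union_le _ _))
  push_cast at h4
  linarith

/-- A finite uniform covering number provides, on every sample, a finite cover by members of the
class. -/
lemma exists_finset_cover {S : Type*} {r : ℝ≥0} {F : Set (S → ℝ)} {T k : ℕ}
    (hk : coveringNumberL1 r F T ≤ k) (x : Fin T → S) :
    ∃ C : Finset (S → ℝ), ↑C ⊆ F ∧ C.card ≤ k ∧
      ∀ f ∈ F, ∃ g ∈ C, ∑ t, |f (x t) - g (x t)| ≤ T * r := by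
  classical
  set φ : (S → ℝ) → PiLp 1 fun _ : Fin T => ℝ := fun f => WithLp.toLp 1 fun t => f (x t) with hφ
  have hx : Metric.coveringNumber (T * r) (φ '' F) ≤ k :=
    (le_iSup (fun x : Fin T → S => Metric.coveringNumber (T * r)
      ((fun f : S → ℝ => (WithLp.toLp 1 fun t => f (x t) : PiLp 1 fun _ : Fin T => ℝ)) '' F))
      x).trans hk
  obtain ⟨D, hDsub, hDfin, hDcov, hDcard⟩ := Metric.exists_set_encard_eq_coveringNumber
    (ne_top_of_le_ne_top (ENat.natCast_ne_top k) hx)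
  have hDsub' : ∀ y ∈ D, ∃ f, f ∈ F ∧ φ f = y := fun y hy => hDsub hy
  choose! ψ hψF hψ using hDsub'
  refine ⟨hDfin.toFinset.image ψ, ?_, ?_, ?_⟩
  · intro f hf
    simp only [Finset.coe_image, Set.Finite.coe_toFinset, Set.mem_image] at hf
    obtain ⟨y, hy, rfl⟩ := hf
    exact hψF y hy
  · refine Finset.card_image_le.trans ?_
    rw [hDfin.encard_eq_coe_toFinset_card] at hDcard
    exact_mod_cast hDcard.trans_le hx
  · intro f hf
    obtain ⟨y, hy, hfy⟩ := hDcov (Set.mem_image_of_mem φ hf)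
    refine ⟨ψ y, Finset.mem_image_of_mem _ (hDfin.mem_toFinset.2 hy), ?_⟩
    have h1 : edist (φ f) (φ (ψ y)) ≤ ((T * r : ℝ≥0) : ℝ≥0∞) := by
      rw [hψ y hy]; exact hfy
    rw [edist_dist, PiLp.dist_eq_of_L1] at h1
    have h2 := (ENNReal.ofReal_le_iff_le_toReal ENNReal.coe_ne_top).1 h1
    simpa [hφ, Real.dist_eq] using h2

open scoped Classical in
/-- For a fixed sample, few sign patterns of the blocks make a symmetrized sum over the sample large
for some member of the class: Hoeffding's inequality for each member of a finite cover, and a union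
bound. Here `j t` is the block of the sample point `t`, and only the points in `O` are used. -/
lemma card_sign_exists_le {S : Type*} {r : ℝ≥0} {F : Set (S → ℝ)} {T n k a : ℕ} {K θ : ℝ}
    (hK : 0 < K) (hn : 0 < n) (ha : 0 < a) (hF : ∀ f ∈ F, ∀ x, f x ∈ Set.Icc (-K) 0)
    (hk : coveringNumberL1 r F T ≤ k) (j : Fin T → Fin n) (O : Finset (Fin T))
    (hcard : ∀ i, (O.filter fun t => j t = i).card ≤ a) (hθ : 0 ≤ θ) (x : Fin T → S) :
    ((Finset.univ.filter fun σ : Fin n → Bool =>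
        ∃ f ∈ F, θ + T * r ≤ |∑ t ∈ O, boolSign (σ (j t)) * f (x t)|).card : ℝ) ≤
      2 ^ n * (2 * k * Real.exp (-(θ ^ 2 / (2 * (n * (a * K) ^ 2))))) := by
  classical
  obtain ⟨C, hCF, hCk, hC⟩ := exists_finset_cover hk x
  set V : ℝ := n * (a * K) ^ 2 with hVdef
  have hV : 0 < V := by positivity
  have hblock : ∀ (g : S → ℝ) (σ : Fin n → Bool), ∑ t ∈ O, boolSign (σ (j t)) * g (x t) =
      ∑ i, boolSign (σ i) * ∑ t ∈ O with j t = i, g (x t) := fun g σ => by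
    rw [← Finset.sum_fiberwise O j]
    refine Finset.sum_congr rfl fun i _ => ?_
    rw [Finset.mul_sum]
    refine Finset.sum_congr rfl fun t ht => ?_
    rw [(Finset.mem_filter.1 ht).2]
  have hy : ∀ g ∈ C, ∑ i, (∑ t ∈ O with j t = i, g (x t)) ^ 2 ≤ V := fun g hg => by
    have h1 : ∀ i : Fin n, (∑ t ∈ O with j t = i, g (x t)) ^ 2 ≤ (a * K) ^ 2 := fun i => by
      refine sq_le_sq' ?_ ?_
      · have h2 : ∑ t ∈ O with j t = i, (-K) ≤ ∑ t ∈ O with j t = i, g (x t) :=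
          Finset.sum_le_sum fun t _ => (hF g (hCF hg) (x t)).1
        rw [Finset.sum_const, nsmul_eq_mul] at h2
        have h3 : ((O.filter fun t => j t = i).card : ℝ) ≤ a := Nat.cast_le.2 (hcard i)
        nlinarith
      · exact (Finset.sum_nonpos fun t _ => (hF g (hCF hg) (x t)).2).trans (by positivity)
    refine (Finset.sum_le_sum fun i _ => h1 i).trans ?_
    simp [hVdef]
  have hsub : (Finset.univ.filter fun σ : Fin n → Bool =>
        ∃ f ∈ F, θ + T * r ≤ |∑ t ∈ O, boolSign (σ (j t)) * f (x t)|) ⊆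
      C.biUnion fun g => Finset.univ.filter fun σ : Fin n → Bool =>
        θ ≤ |∑ i, boolSign (σ i) * ∑ t ∈ O with j t = i, g (x t)| := by
    intro σ hσ
    obtain ⟨f, hf, hfσ⟩ := (Finset.mem_filter.1 hσ).2
    obtain ⟨g, hg, hfg⟩ := hC f hf
    refine Finset.mem_biUnion.2 ⟨g, hg, Finset.mem_filter.2 ⟨Finset.mem_univ _, ?_⟩⟩
    rw [← hblock]
    have h1 : |∑ t ∈ O, boolSign (σ (j t)) * f (x t)| -
        |∑ t ∈ O, boolSign (σ (j t)) * g (x t)| ≤ ∑ t, |f (x t) - g (x t)| := by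
      refine (abs_sub_abs_le_abs_sub _ _).trans ?_
      rw [← Finset.sum_sub_distrib]
      refine (Finset.abs_sum_le_sum_abs _ _).trans ?_
      refine le_trans (le_of_eq ?_) (Finset.sum_le_univ_sum_of_nonneg (s := O)
        fun t => abs_nonneg (f (x t) - g (x t)))
      refine Finset.sum_congr rfl fun t _ => ?_
      rw [← mul_sub, abs_mul, abs_boolSign, one_mul]
    linarith
  have h5 : ∀ g ∈ C, ((Finset.univ.filter fun σ : Fin n → Bool =>
        θ ≤ |∑ i, boolSign (σ i) * ∑ t ∈ O with j t = i, g (x t)|).card : ℝ) ≤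
      2 ^ n * (2 * Real.exp (-(θ ^ 2 / (2 * V)))) := fun g hg => by
    simpa using card_le_abs_rademacher_sum (fun i => ∑ t ∈ O with j t = i, g (x t)) hV
      (hy g hg) hθ
  calc _ ≤ ((C.biUnion fun g => Finset.univ.filter fun σ : Fin n → Bool =>
        θ ≤ |∑ i, boolSign (σ i) * ∑ t ∈ O with j t = i, g (x t)|).card : ℝ) :=
        Nat.cast_le.2 (Finset.card_le_card hsub)
    _ ≤ ∑ g ∈ C, ((Finset.univ.filter fun σ : Fin n → Bool =>
        θ ≤ |∑ i, boolSign (σ i) * ∑ t ∈ O with j t = i, g (x t)|).card : ℝ) := by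
        exact_mod_cast Finset.card_biUnion_le
    _ ≤ ∑ _g ∈ C, 2 ^ n * (2 * Real.exp (-(θ ^ 2 / (2 * V)))) := Finset.sum_le_sum h5
    _ = C.card * (2 ^ n * (2 * Real.exp (-(θ ^ 2 / (2 * V))))) := by
        rw [Finset.sum_const, nsmul_eq_mul]
    _ ≤ k * (2 ^ n * (2 * Real.exp (-(θ ^ 2 / (2 * V))))) := by gcongr
    _ = 2 ^ n * (2 * k * Real.exp (-(θ ^ 2 / (2 * V)))) := by ring

/-! ### Symmetrization for independent blocks -/

/-- Chebyshev's inequality for a sum over a sample with independent blocks: the points of block `i`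
are functions of the `i`-th coordinate of a product space, and a block has at most `a` of them. -/
lemma pi_le_abs_sum_le_half {S Y : Type*} [MeasurableSpace S] [MeasurableSpace Y] {T n a : ℕ}
    {K h : ℝ} (hK : 0 < K) (μ : Fin n → Measure Y) [∀ i, IsProbabilityMeasure (μ i)]
    {f : S → ℝ} (hfm : Measurable f) (hf : ∀ x, f x ∈ Set.Icc (-K) 0)
    {e : Fin T → Y → S} (he : ∀ t, Measurable (e t)) (j : Fin T → Fin n) (O : Finset (Fin T))
    (hcard : ∀ i, (O.filter fun t => j t = i).card ≤ a) {m : ℝ}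
    (hmean : ∀ t ∈ O, ∫ y, f (e t y) ∂(μ (j t)) = m)
    (hh : 0 < h) (hcheb : 2 * (n * (a * K) ^ 2) ≤ h ^ 2) :
    Measure.pi μ {z | h ≤ |∑ t ∈ O, (f (e t (z (j t))) - m)|} ≤ 1 / 2 := by
  set X : Fin n → Y → ℝ := fun i y => ∑ t ∈ O with j t = i, (f (e t y) - m) with hX
  have hXm : ∀ i, Measurable (X i) := fun i =>
    Finset.measurable_sum _ fun t _ => (hfm.comp (he t)).sub_const _
  have hXb : ∀ i y, X i y ∈ Set.Icc ((O.filter fun t => j t = i).card * (-K - m))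
      ((O.filter fun t => j t = i).card * (0 - m)) := fun i y => by
    rw [← nsmul_eq_mul, ← nsmul_eq_mul, ← Finset.sum_const, ← Finset.sum_const]
    exact ⟨Finset.sum_le_sum fun t _ => sub_le_sub_right (hf _).1 _,
      Finset.sum_le_sum fun t _ => sub_le_sub_right (hf _).2 _⟩
  have hXL : ∀ i, MemLp (X i) 2 (μ i) := fun i =>
    memLp_of_bounded (Filter.Eventually.of_forall (hXb i)) (hXm i).aestronglyMeasurable 2
  have hsum : (fun z : Fin n → Y => ∑ t ∈ O, (f (e t (z (j t))) - m)) =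
      ∑ i, fun z : Fin n → Y => X i (z i) := by
    ext z
    rw [Finset.sum_apply, ← Finset.sum_fiberwise O j]
    refine Finset.sum_congr rfl fun i _ => Finset.sum_congr rfl fun t ht => ?_
    rw [(Finset.mem_filter.1 ht).2]
  have hint : ∀ i, Integrable (X i) (μ i) := fun i => (hXL i).integrable (by norm_num)
  have hfint : ∀ t i, Integrable (fun y => f (e t y)) (μ i) := fun t i =>
    (memLp_of_bounded (Filter.Eventually.of_forall fun y => hf (e t y))
      (hfm.comp (he t)).aestronglyMeasurable 1).integrable le_rfl
  have hX0 : ∀ i, ∫ y, X i y ∂(μ i) = 0 := fun i => by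
    have hfm_int : ∀ t, Integrable (fun y => f (e t y) - m) (μ i) := fun t =>
      (hfint t i).sub (integrable_const _)
    change ∫ y, ∑ t ∈ O with j t = i, (f (e t y) - m) ∂(μ i) = 0
    rw [integral_finsetSum _ fun t _ => hfm_int t]
    refine Finset.sum_eq_zero fun t ht => ?_
    obtain ⟨htO, hti⟩ := Finset.mem_filter.1 ht
    rw [integral_sub (hfint t i) (integrable_const _), ← hti, hmean t htO]
    simp
  have hL : MemLp (∑ i, fun z : Fin n → Y => X i (z i)) 2 (Measure.pi μ) :=
    memLp_finsetSum' _ fun i _ => (hXL i).comp_measurePreserving (measurePreserving_eval μ i)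
  have hmean0 : ∫ z, (∑ i, fun z : Fin n → Y => X i (z i)) z ∂(Measure.pi μ) = 0 := by
    simp only [Finset.sum_apply]
    have hint' : ∀ i, Integrable (fun z : Fin n → Y => X i (z i)) (Measure.pi μ) := fun i =>
      (measurePreserving_eval μ i).integrable_comp_of_integrable (hint i)
    rw [integral_finsetSum _ fun i _ => hint' i]
    refine Finset.sum_eq_zero fun i _ => ?_
    rw [integral_comp_eval (hXm i).aestronglyMeasurable, hX0]
  have hvar : Var[∑ i, fun z : Fin n → Y => X i (z i); Measure.pi μ] ≤ n * (a * K) ^ 2 := by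
    rw [variance_sum_pi hXL]
    refine (Finset.sum_le_sum fun i _ => ?_ : _ ≤ ∑ _i : Fin n, (a * K) ^ 2).trans (by simp)
    refine (variance_le_sq_of_bounded (Filter.Eventually.of_forall (hXb i))
      (hXm i).aemeasurable).trans ?_
    have h3 : ((O.filter fun t => j t = i).card : ℝ) ≤ a := Nat.cast_le.2 (hcard i)
    have h4 : (0 : ℝ) ≤ ((O.filter fun t => j t = i).card : ℝ) := Nat.cast_nonneg _
    refine pow_le_pow_left₀ ?_ ?_ 2 <;> nlinarith
  have key := meas_ge_le_variance_div_sq hL hh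
  rw [hmean0] at key
  simp only [sub_zero] at key
  rw [← hsum] at key hvar
  refine key.trans ?_
  rw [show (1 / 2 : ℝ≥0∞) = ENNReal.ofReal (1 / 2) by
    rw [ENNReal.ofReal_div_of_pos two_pos]; simp]
  refine ENNReal.ofReal_le_ofReal ?_
  rw [div_le_div_iff₀ (by positivity) two_pos]
  linarith

/-- Fubini's theorem for outer measures: no measurability of `A` and `B` is needed. -/
lemma measure_le_two_mul_prod {Z : Type*} [MeasurableSpace Z] (M : Measure Z) [SFinite M]
    {A : Set Z} {B : Set (Z × Z)} (h : ∀ z ∈ A, 1 / 2 ≤ M (Prod.mk z ⁻¹' B)) :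
    M A ≤ 2 * (M.prod M) B := by
  rw [← measure_toMeasurable B, Measure.prod_apply (measurableSet_toMeasurable _ _)]
  have hA : A ⊆ {z | 1 / 2 ≤ M (Prod.mk z ⁻¹' toMeasurable (M.prod M) B)} := fun z hz =>
    (h z hz).trans (measure_mono (Set.preimage_mono (subset_toMeasurable _ _)))
  have h1 := mul_meas_ge_le_lintegral (μ := M)
    (measurable_measure_prodMk_left (ν := M) (measurableSet_toMeasurable (M.prod M) B)) (1 / 2)
  calc M A = 2 * (1 / 2 * M A) := by
        rw [← mul_assoc, one_div, ENNReal.mul_inv_cancel two_ne_zero ENNReal.ofNat_ne_top, one_mul]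
    _ ≤ _ := by
        gcongr
        exact le_trans (by gcongr) h1

/-- Exchanging the sample and the ghost sample in the blocks where `σ` is false preserves the
joint law of the two samples. -/
lemma measurePreserving_exchange {Y : Type*} [MeasurableSpace Y] {n : ℕ} (μ : Fin n → Measure Y)
    [∀ i, IsProbabilityMeasure (μ i)] (σ : Fin n → Bool) :
    MeasurePreserving (fun (p : Fin n → Y × Y) i => (if σ i then id else Prod.swap) (p i))
      (Measure.pi fun i => (μ i).prod (μ i)) (Measure.pi fun i => (μ i).prod (μ i)) := by
  refine measurePreserving_pi _ _ fun i => ?_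
  cases σ i
  · simpa using Measure.measurePreserving_swap (μ := μ i) (ν := μ i)
  · simpa using MeasurePreserving.id _

/-- If, at every point, at most `c` of finitely many null measurable sets hold, then their
probabilities sum to at most `c`. -/
lemma sum_measure_le_of_card_le {Z ι : Type*} [MeasurableSpace Z] [Fintype ι] (M : Measure Z)
    [IsProbabilityMeasure M] {A : ι → Set Z} (hA : ∀ i, NullMeasurableSet (A i) M) {c : ℝ≥0∞}
    (h : ∀ z, (({i | z ∈ A i}.ncard : ℕ) : ℝ≥0∞) ≤ c) : ∑ i, M (A i) ≤ c := by
  classical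
  calc ∑ i, M (A i) = ∑ i, ∫⁻ z, (A i).indicator 1 z ∂M :=
        Finset.sum_congr rfl fun i _ => (lintegral_indicator_one₀ (hA i)).symm
    _ = ∫⁻ z, ∑ i, (A i).indicator 1 z ∂M :=
        (lintegral_finsetSum' _ fun i _ => aemeasurable_one.indicator₀ (hA i)).symm
    _ ≤ ∫⁻ _z, c ∂M := by
        refine lintegral_mono fun z => le_trans (le_of_eq ?_) (h z)
        simp only [Set.indicator_apply, Pi.one_apply, Finset.sum_boole]
        rw [Set.ncard_eq_toFinset_card']
        simp
    _ = c := by simp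

/-- The uniform deviation inequality for a sample with independent blocks. The blocks are
the coordinates of a product space; `e t (z (j t))` is the sample point `t`, and only the points in
`O` are used. Splitting `c = 2 θ' + h`, the amount `h` is spent on a ghost sample, `θ'` remains for
each of the two samples after a random exchange of their blocks, and it exceeds the threshold `θ`
in Hoeffding's inequality by the radius of the cover. -/
theorem pi_exists_deviation_le {S Y : Type*} [MeasurableSpace S] [MeasurableSpace Y]
    {r : ℝ≥0} {F : Set (S → ℝ)} {T n k a : ℕ} {K c h θ θ' : ℝ}
    (hK : 0 < K) (hn : 0 < n) (ha : 0 < a) (μ : Fin n → Measure Y) [∀ i, IsProbabilityMeasure (μ i)]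
    (hFm : ∀ f ∈ F, Measurable f) (hF : ∀ f ∈ F, ∀ x, f x ∈ Set.Icc (-K) 0)
    (hcl : IsMeasurableClass F)
    {e : Fin T → Y → S} (he : ∀ t, Measurable (e t)) (j : Fin T → Fin n) (O : Finset (Fin T))
    (hcard : ∀ i, (O.filter fun t => j t = i).card ≤ a) {m : (S → ℝ) → ℝ}
    (hmean : ∀ f ∈ F, ∀ t ∈ O, ∫ y, f (e t y) ∂(μ (j t)) = m f)
    (hk : coveringNumberL1 r F T ≤ k)
    (hh : 0 < h) (hcheb : 2 * (n * (a * K) ^ 2) ≤ h ^ 2) (hc : c = 2 * θ' + h)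
    (hθ : 0 ≤ θ) (hθ' : θ + T * r < θ') :
    Measure.pi μ {z | ∃ f ∈ F, c < |∑ t ∈ O, (f (e t (z (j t))) - m f)|} ≤
      8 * k * ENNReal.ofReal (Real.exp (-(θ ^ 2 / (2 * (n * (a * K) ^ 2))))) := by
  classical
  set M := Measure.pi μ with hM
  set E : ℝ := Real.exp (-(θ ^ 2 / (2 * (n * (a * K) ^ 2)))) with hE
  set M2 : Measure (Fin n → Y × Y) := Measure.pi fun i => (μ i).prod (μ i) with hM2
  set B : Set ((Fin n → Y) × (Fin n → Y)) := {p | ∃ f ∈ F, c - h <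
    |∑ t ∈ O, (f (e t (p.1 (j t))) - f (e t (p.2 (j t))))|} with hB
  -- a ghost sample has a small deviation with probability at least one half
  have hghost : M {z | ∃ f ∈ F, c < |∑ t ∈ O, (f (e t (z (j t))) - m f)|} ≤ 2 * (M.prod M) B := by
    refine measure_le_two_mul_prod M ?_
    rintro z ⟨f, hf, hz⟩
    set D := {z : Fin n → Y | h ≤ |∑ t ∈ O, (f (e t (z (j t))) - m f)|} with hD
    have hDm : MeasurableSet D := by
      refine measurableSet_le measurable_const (Measurable.abs ?_)
      exact Finset.measurable_sum _ fun t _ =>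
        ((hFm f hf).comp ((he t).comp (measurable_pi_apply _))).sub_const _
    have h1 : M D ≤ 1 / 2 := pi_le_abs_sum_le_half hK μ (hFm f hf) (hF f hf) he j O hcard
      (hmean f hf) hh hcheb
    have h2 : 1 / 2 ≤ M Dᶜ := by
      rw [prob_compl_eq_one_sub hDm]
      refine le_trans (le_of_eq ?_) (tsub_le_tsub_left h1 1)
      rw [one_div, ENNReal.one_sub_inv_two]
    refine h2.trans (measure_mono fun z' hz' => ⟨f, hf, ?_⟩)
    have h3 : |∑ t ∈ O, (f (e t (z' (j t))) - m f)| < h := not_le.1 hz'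
    have h4 : ∑ t ∈ O, (f (e t (z (j t))) - f (e t (z' (j t)))) =
        ∑ t ∈ O, (f (e t (z (j t))) - m f) - ∑ t ∈ O, (f (e t (z' (j t))) - m f) := by
      rw [← Finset.sum_sub_distrib]
      exact Finset.sum_congr rfl fun t _ => by ring
    have h5 := abs_sub_abs_le_abs_sub (∑ t ∈ O, (f (e t (z (j t))) - m f))
      (∑ t ∈ O, (f (e t (z' (j t))) - m f))
    change c - h < |∑ t ∈ O, (f (e t (z (j t))) - f (e t (z' (j t))))|
    rw [h4]
    linarith
  set G : (Fin n → Bool) → (Fin n → Y) → ℝ := fun σ z => ⨆ f : F,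
    |∑ t, (if t ∈ O then boolSign (σ (j t)) else 0) * f.1 (e t (z (j t)))| with hG
  set A : (Fin n → Bool) → Set (Fin n → Y) := fun σ => {z | θ' ≤ G σ z} with hA
  have hw : ∀ (σ : Fin n → Bool) (f : S → ℝ) (z : Fin n → Y),
      ∑ t, (if t ∈ O then boolSign (σ (j t)) else 0) * f (e t (z (j t))) =
        ∑ t ∈ O, boolSign (σ (j t)) * f (e t (z (j t))) := fun σ f z => by
    simp [ite_mul, Finset.sum_ite_mem]
  have hAmeas : ∀ σ, NullMeasurableSet (A σ) M := fun σ => by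
    have hΦ : Measurable fun (z : Fin n → Y) (t : Fin T) => e t (z (j t)) :=
      measurable_pi_iff.2 fun t => (he t).comp (measurable_pi_apply _)
    have := hcl T (fun t => if t ∈ O then boolSign (σ (j t)) else 0)
      (M.map fun z t => e t (z (j t))) (Measure.isProbabilityMeasure_map hΦ.aemeasurable)
    exact nullMeasurableSet_le aemeasurable_const (this.comp_measurable hΦ)
  have hle : ∀ (σ : Fin n → Bool) (z : Fin n → Y), ∀ f ∈ F,
      |∑ t ∈ O, boolSign (σ (j t)) * f (e t (z (j t)))| ≤ G σ z := fun σ z f hf => by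
    rw [← hw]
    refine le_ciSup (f := fun f : F => |∑ t, (if t ∈ O then boolSign (σ (j t)) else 0) *
      f.1 (e t (z (j t)))|) ⟨∑ _t ∈ O, K, ?_⟩ ⟨f, hf⟩
    rintro _ ⟨g, rfl⟩
    simp only [hw]
    refine (Finset.abs_sum_le_sum_abs _ _).trans (Finset.sum_le_sum fun t _ => ?_)
    rw [abs_mul, abs_boolSign, one_mul, abs_le]
    have := hF g.1 g.2 (e t (z (j t)))
    exact ⟨this.1, this.2.trans hK.le⟩
  -- exchanging blocks according to `σ`, then splitting the difference between the two samples
  have hexchange : ∀ σ, (M.prod M) B ≤ 2 * M (A σ) := fun σ => by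
    set Bσ : Set (Fin n → Y × Y) := {p | ∃ f ∈ F, c - h < |∑ t ∈ O, boolSign (σ (j t)) *
      (f (e t (p (j t)).1) - f (e t (p (j t)).2))|} with hBσ
    have h1 : (M.prod M) B = M2 ((MeasurableEquiv.arrowProdEquivProdArrow Y Y (Fin n)) ⁻¹' B) :=
      ((measurePreserving_arrowProdEquivProdArrow Y Y (Fin n) μ μ).measure_preimage_equiv B).symm
    have hflip := measurePreserving_exchange μ σ
    have h2 : (MeasurableEquiv.arrowProdEquivProdArrow Y Y (Fin n)) ⁻¹' B ⊆
        (fun (p : Fin n → Y × Y) i => (if σ i then id else Prod.swap) (p i)) ⁻¹' Bσ := by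
      rintro p ⟨f, hf, hp⟩
      refine ⟨f, hf, hp.trans_le (le_of_eq ?_)⟩
      congr 1
      refine Finset.sum_congr rfl fun t _ => ?_
      change f (e t (p (j t)).1) - f (e t (p (j t)).2) = _
      cases hσ : σ (j t) <;> simp [boolSign, hσ]
    have h3 : Bσ ⊆ (fun p i => (p i).1) ⁻¹' A σ ∪ (fun p i => (p i).2) ⁻¹' A σ := by
      rintro p ⟨f, hf, hp⟩
      have h4 : ∑ t ∈ O, boolSign (σ (j t)) * (f (e t (p (j t)).1) - f (e t (p (j t)).2)) =
          ∑ t ∈ O, boolSign (σ (j t)) * f (e t (p (j t)).1) -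
            ∑ t ∈ O, boolSign (σ (j t)) * f (e t (p (j t)).2) := by
        rw [← Finset.sum_sub_distrib]
        exact Finset.sum_congr rfl fun t _ => by ring
      rw [h4] at hp
      have h5 := abs_sub (∑ t ∈ O, boolSign (σ (j t)) * f (e t (p (j t)).1))
        (∑ t ∈ O, boolSign (σ (j t)) * f (e t (p (j t)).2))
      have h6 := hle σ (fun i => (p i).1) f hf
      have h7 := hle σ (fun i => (p i).2) f hf
      by_contra hcon
      rw [Set.mem_union, not_or] at hcon
      have h8 : G σ (fun i => (p i).1) < θ' := not_le.1 hcon.1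
      have h9 : G σ (fun i => (p i).2) < θ' := not_le.1 hcon.2
      linarith
    have hfst : MeasurePreserving (fun (p : Fin n → Y × Y) i => (p i).1) M2 M :=
      measurePreserving_pi _ _ fun i => measurePreserving_fst
    have hsnd : MeasurePreserving (fun (p : Fin n → Y × Y) i => (p i).2) M2 M :=
      measurePreserving_pi _ _ fun i => measurePreserving_snd
    calc (M.prod M) B ≤ M2 ((fun (p : Fin n → Y × Y) i =>
          (if σ i then id else Prod.swap) (p i)) ⁻¹' Bσ) := h1.trans_le (measure_mono h2)
      _ ≤ M2 Bσ := (Measure.le_map_apply hflip.aemeasurable _).trans_eq (by rw [hflip.map_eq])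
      _ ≤ M2 ((fun p i => (p i).1) ⁻¹' A σ) + M2 ((fun p i => (p i).2) ⁻¹' A σ) :=
          (measure_mono h3).trans (measure_union_le _ _)
      _ ≤ M (A σ) + M (A σ) := add_le_add
          ((Measure.le_map_apply hfst.aemeasurable _).trans_eq (by rw [hfst.map_eq]))
          ((Measure.le_map_apply hsnd.aemeasurable _).trans_eq (by rw [hsnd.map_eq]))
      _ = 2 * M (A σ) := (two_mul _).symm
  -- for a fixed sample, few of the sign patterns `σ` are bad
  have hpatterns : ∑ σ, M (A σ) ≤ 2 ^ n * (2 * k * ENNReal.ofReal E) := by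
    refine sum_measure_le_of_card_le M hAmeas fun z => ?_
    have h1 := card_sign_exists_le hK hn ha hF hk j O hcard hθ fun t => e t (z (j t))
    have h2 : {σ | z ∈ A σ}.ncard ≤ (Finset.univ.filter fun σ : Fin n → Bool =>
        ∃ f ∈ F, θ + T * r ≤ |∑ t ∈ O, boolSign (σ (j t)) * f (e t (z (j t)))|).card := by
      rw [← Set.ncard_coe_finset]
      refine Set.ncard_le_ncard (fun σ hσ => ?_) (Set.toFinite _)
      simp only [Finset.coe_filter, Finset.mem_univ, true_and, Set.mem_ofPred_eq]
      by_contra! hcon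
      have h3 : θ' ≤ θ + T * r := le_trans (show θ' ≤ _ from hσ) <|
        Real.iSup_le (fun f => by rw [hw]; exact (hcon f.1 f.2).le) (by positivity)
      linarith
    have h4 : (2 ^ n * (2 * k * ENNReal.ofReal E) : ℝ≥0∞) =
        ENNReal.ofReal (2 ^ n * (2 * k * E)) := by
      have hE0 : 0 ≤ E := (Real.exp_pos _).le
      rw [ENNReal.ofReal_mul (by positivity), ENNReal.ofReal_mul (by positivity),
        ENNReal.ofReal_mul (by positivity), ENNReal.ofReal_pow (by positivity)]
      simp
    rw [h4, ← ENNReal.ofReal_natCast]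
    exact ENNReal.ofReal_le_ofReal ((Nat.cast_le.2 h2).trans h1)
  have haverage : (2 ^ n : ℝ≥0∞) * (M.prod M) B ≤ 2 ^ n * (4 * k * ENNReal.ofReal E) := by
    calc (2 ^ n : ℝ≥0∞) * (M.prod M) B = ∑ _σ : Fin n → Bool, (M.prod M) B := by simp
      _ ≤ ∑ σ, 2 * M (A σ) := Finset.sum_le_sum fun σ _ => hexchange σ
      _ = 2 * ∑ σ, M (A σ) := Finset.mul_sum _ _ _ |>.symm
      _ ≤ 2 * (2 ^ n * (2 * k * ENNReal.ofReal E)) := by gcongr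
      _ = _ := by ring
  have hsymm := (ENNReal.mul_le_mul_iff_right (by positivity) (by finiteness)).1 haverage
  calc _ ≤ 2 * (M.prod M) B := hghost
    _ ≤ 2 * (4 * k * ENNReal.ofReal E) := by gcongr
    _ = 8 * k * ENNReal.ofReal E := by ring

/-! ### Total variation distance and decoupling of blocks -/

lemma abs_measureReal_sub_le_one {S : Type*} [MeasurableSpace S] (μ ν : Measure S)
    [IsProbabilityMeasure μ] [IsProbabilityMeasure ν] (C : Set S) :
    |μ.real C - ν.real C| ≤ 1 := by
  have h1 : μ.real C ≤ 1 := measureReal_le_one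
  have h2 : ν.real C ≤ 1 := measureReal_le_one
  have h3 : 0 ≤ μ.real C := measureReal_nonneg
  have h4 : 0 ≤ ν.real C := measureReal_nonneg
  rw [abs_le]
  constructor <;> linarith

lemma tvDist_le_one {S : Type*} [MeasurableSpace S] (μ ν : Measure S)
    [IsProbabilityMeasure μ] [IsProbabilityMeasure ν] : tvDist μ ν ≤ 1 :=
  Real.iSup_le (fun C => abs_measureReal_sub_le_one μ ν C.1) zero_le_one

lemma abs_measureReal_sub_le_tvDist {S : Type*} [MeasurableSpace S] (μ ν : Measure S)
    [IsProbabilityMeasure μ] [IsProbabilityMeasure ν] {C : Set S} (hC : MeasurableSet C) :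
    |μ.real C - ν.real C| ≤ tvDist μ ν :=
  le_ciSup (f := fun C : {C : Set S // MeasurableSet C} => |μ.real C.1 - ν.real C.1|)
    ⟨1, by rintro _ ⟨C, rfl⟩; exact abs_measureReal_sub_le_one μ ν C.1⟩ ⟨C, hC⟩

lemma measure_le_add_tvDist {S : Type*} [MeasurableSpace S] (μ ν : Measure S)
    [IsProbabilityMeasure μ] [IsProbabilityMeasure ν] {C : Set S} (hC : MeasurableSet C) :
    μ C ≤ ν C + ENNReal.ofReal (tvDist μ ν) := by
  have h1 := (le_abs_self _).trans (abs_measureReal_sub_le_tvDist μ ν hC)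
  rw [← ofReal_measureReal (μ := μ), ← ofReal_measureReal (μ := ν),
    ← ENNReal.ofReal_add measureReal_nonneg ((abs_nonneg _).trans
      (abs_measureReal_sub_le_tvDist μ ν hC))]
  exact ENNReal.ofReal_le_ofReal (by linarith)

/-- The integrals of a function with values in an interval of length `K` differ by at most `K` times
the total variation distance, by the layer cake formula. -/
lemma abs_integral_sub_le_tvDist {S : Type*} [MeasurableSpace S] (μ ν : Measure S)
    [IsProbabilityMeasure μ] [IsProbabilityMeasure ν] {f : S → ℝ} {K : ℝ} (hK : 0 ≤ K)
    (hfm : Measurable f) (hf : ∀ x, f x ∈ Set.Icc (-K) 0) :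
    |∫ x, f x ∂μ - ∫ x, f x ∂ν| ≤ K * tvDist μ ν := by
  have hint : ∀ (ρ : Measure S) [IsProbabilityMeasure ρ], Integrable f ρ := fun ρ _ =>
    (memLp_of_bounded (Filter.Eventually.of_forall hf) hfm.aestronglyMeasurable 1).integrable le_rfl
  have key : ∀ (ρ : Measure S) [IsProbabilityMeasure ρ],
      ∫ x, f x ∂ρ + K = ∫ t in Set.Ioc 0 K, ρ.real {x | t ≤ f x + K} := fun ρ _ => by
    have h1 : ∫ x, (f x + K) ∂ρ = ∫ x, f x ∂ρ + K := by
      rw [integral_add (hint ρ) (integrable_const _)]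
      simp
    rw [← h1]
    refine Integrable.integral_eq_integral_Ioc_meas_le ((hint ρ).add (integrable_const _))
      (Filter.Eventually.of_forall fun x => ?_) (Filter.Eventually.of_forall fun x => ?_)
    · have := (hf x).1
      change 0 ≤ f x + K
      linarith
    · have := (hf x).2
      change f x + K ≤ K
      linarith
  have hanti : ∀ (ρ : Measure S) [IsProbabilityMeasure ρ],
      IntegrableOn (fun t => ρ.real {x | t ≤ f x + K}) (Set.Ioc 0 K) := fun ρ _ => by
    have : Antitone fun t => ρ.real {x | t ≤ f x + K} := fun t t' htt' =>
      measureReal_mono fun x (hx : t' ≤ f x + K) => htt'.trans hx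
    exact (this.antitoneOn _).integrableOn_isCompact isCompact_Icc |>.mono_set Set.Ioc_subset_Icc_self
  have h2 : ∫ x, f x ∂μ - ∫ x, f x ∂ν =
      ∫ t in Set.Ioc 0 K, (μ.real {x | t ≤ f x + K} - ν.real {x | t ≤ f x + K}) := by
    rw [integral_sub (hanti μ) (hanti ν), ← key μ, ← key ν]
    ring
  rw [h2, ← Real.norm_eq_abs]
  refine (norm_setIntegral_le_of_norm_le_const (C := tvDist μ ν) (by simp) fun t _ => ?_).trans ?_
  · exact abs_measureReal_sub_le_tvDist μ ν (measurableSet_le measurable_const (hfm.add_const K))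
  · simp [hK, mul_comm]

/-- Past and future of a process, `m` steps apart, can be made independent at the cost of
`betaMixing`. The past and the future enter through measurable functions. -/
lemma map_prodMk_le_add_betaMixing {Ω S Y Z : Type*} [MeasurableSpace Ω] [MeasurableSpace S]
    [MeasurableSpace Y] [MeasurableSpace Z] (P : Measure Ω) [IsProbabilityMeasure P]
    {X : ℕ → Ω → S} (hX : ∀ t, Measurable (X t)) (t m : ℕ)
    {φ : (Fin (t + 1) → S) → Y} (hφ : Measurable φ) {ψ : (ℕ → S) → Z} (hψ : Measurable ψ)
    {C : Set (Y × Z)} (hC : MeasurableSet C) :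
    P.map (fun ω => (φ fun i => X i ω, ψ fun i => X (t + m + i) ω)) C ≤
      ((P.map fun ω => φ fun i => X i ω).prod (P.map fun ω => ψ fun i => X (t + m + i) ω)) C +
        ENNReal.ofReal (betaMixing P X m) := by
  have hp : ∀ t, Measurable fun ω => (fun i : Fin (t + 1) => X i ω) := fun t =>
    measurable_pi_iff.2 fun i => hX i
  have hf : ∀ t, Measurable fun ω => (fun i : ℕ => X (t + m + i) ω) := fun t =>
    measurable_pi_iff.2 fun i => hX _
  have hpf : ∀ t, Measurable fun ω =>
      ((fun i : Fin (t + 1) => X i ω), (fun i : ℕ => X (t + m + i) ω)) := fun t =>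
    (hp t).prodMk (hf t)
  have hφψ : Measurable (Prod.map φ ψ) := hφ.prodMap hψ
  have h3 := fun t => Measure.isProbabilityMeasure_map (μ := P) (hp t).aemeasurable
  have h4 := fun t => Measure.isProbabilityMeasure_map (μ := P) (hf t).aemeasurable
  have h5 := fun t => Measure.isProbabilityMeasure_map (μ := P) (hpf t).aemeasurable
  have h1 : P.map (fun ω => (φ fun i => X i ω, ψ fun i => X (t + m + i) ω)) =
      (P.map fun ω => ((fun i : Fin (t + 1) => X i ω), (fun i : ℕ => X (t + m + i) ω))).map
        (Prod.map φ ψ) := by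
    rw [Measure.map_map hφψ (hpf t)]; rfl
  have h2 : (P.map fun ω => φ fun i => X i ω).prod (P.map fun ω => ψ fun i => X (t + m + i) ω) =
      ((P.map fun ω => fun i : Fin (t + 1) => X i ω).prod
        (P.map fun ω => fun i : ℕ => X (t + m + i) ω)).map (Prod.map φ ψ) := by
    rw [← Measure.map_prod_map _ _ hφ hψ, Measure.map_map hφ (hp t), Measure.map_map hψ (hf t)]
    rfl
  rw [h1, h2, Measure.map_apply hφψ hC, Measure.map_apply hφψ hC]
  refine (measure_le_add_tvDist _ ((P.map fun ω => fun i : Fin (t + 1) => X i ω).prod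
    (P.map fun ω => fun i : ℕ => X (t + m + i) ω)) (hφψ hC)).trans ?_
  gcongr
  refine le_ciSup (f := fun t : ℕ => tvDist
    (P.map fun ω => ((fun i : Fin (t + 1) => X i ω), (fun j : ℕ => X (t + m + j) ω)))
    ((P.map fun ω => fun i : Fin (t + 1) => X i ω).prod
      (P.map fun ω => fun j : ℕ => X (t + m + j) ω))) ⟨1, ?_⟩ t
  rintro _ ⟨t, rfl⟩
  exact tvDist_le_one _ _

/-- If each block `Z k` can be made independent of the earlier ones at the cost `b k`, then
all blocks can be made independent at the total cost. -/
lemma map_le_pi_add_sum {Ω Y : Type*} [MeasurableSpace Ω] [MeasurableSpace Y] (P : Measure Ω)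
    [IsProbabilityMeasure P] {Z : ℕ → Ω → Y} (hZ : ∀ k, Measurable (Z k)) (b : ℕ → ℝ≥0∞)
    (h : ∀ k, ∀ C : Set ((Fin k → Y) × Y), MeasurableSet C →
      P.map (fun ω => (fun i : Fin k => Z i ω, Z k ω)) C ≤
        ((P.map fun ω => fun i : Fin k => Z i ω).prod (P.map (Z k))) C + b k) (n : ℕ) :
    ∀ C : Set (Fin n → Y), MeasurableSet C → P.map (fun ω => fun i : Fin n => Z i ω) C ≤
      Measure.pi (fun i : Fin n => P.map (Z i)) C + ∑ k ∈ Finset.range n, b k := by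
  have hprob := fun k => Measure.isProbabilityMeasure_map (μ := P) (hZ k).aemeasurable
  have hp : ∀ n, Measurable fun ω => (fun i : Fin n => Z i ω) := fun n =>
    measurable_pi_iff.2 fun i => hZ i
  have hprob' := fun n => Measure.isProbabilityMeasure_map (μ := P) (hp n).aemeasurable
  induction n with
  | zero =>
    intro C _
    rcases Set.eq_empty_or_nonempty C with rfl | hC
    · simp
    · rw [Subsingleton.eq_univ_of_nonempty hC]
      simp
  | succ n ih =>
    intro C hC
    let e := (MeasurableEquiv.piFinSuccAbove (fun _ : Fin (n + 1) => Y) (Fin.last n))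
    have hmp := measurePreserving_piFinSuccAbove (fun i : Fin (n + 1) => P.map (Z i)) (Fin.last n)
    set C' : Set ((Fin n → Y) × Y) := {p | e.symm p.swap ∈ C} with hC'
    have hC'm : MeasurableSet C' := (e.symm.measurable.comp measurable_swap) hC
    have h1 : P.map (fun ω => fun i : Fin (n + 1) => Z i ω) C =
        P.map (fun ω => (fun i : Fin n => Z i ω, Z n ω)) C' := by
      rw [Measure.map_apply (hp _) hC, Measure.map_apply ((hp n).prodMk (hZ n)) hC'm]
      congr 1
      ext ω
      have : e (fun i => Z i ω) = (Z n ω, fun i : Fin n => Z i ω) := by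
        ext
        · simp [e, MeasurableEquiv.piFinSuccAbove, Fin.insertNthEquiv]
        · simp [e, MeasurableEquiv.piFinSuccAbove, Fin.insertNthEquiv, Fin.init]
      simp only [hC', Set.mem_preimage, Set.mem_ofPred_eq, Prod.swap_prod_mk, ← this,
        MeasurableEquiv.symm_apply_apply]
    have h2 : Measure.pi (fun i : Fin (n + 1) => P.map (Z i)) C =
        ((Measure.pi fun i : Fin n => P.map (Z i)).prod (P.map (Z n))) C' := by
      have h3 : ((Measure.pi fun i : Fin n => P.map (Z i)).prod (P.map (Z n))) C' =
          ((P.map (Z n)).prod (Measure.pi fun i : Fin n => P.map (Z i))) (e.symm ⁻¹' C) := by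
        rw [← Measure.prod_swap, Measure.map_apply measurable_swap hC'm]
        rfl
      rw [h3]
      have h4 := hmp.measure_preimage_equiv (e.symm ⁻¹' C)
      have h5 : e ⁻¹' (e.symm ⁻¹' C) = C := by ext; simp
      simp only [Fin.succAbove_last, Fin.val_last, Fin.val_castSucc] at h4
      rw [← h4]
      exact (congrArg _ h5).symm
    rw [h1, h2, Finset.sum_range_succ, ← add_assoc]
    refine (h n C' hC'm).trans ?_
    gcongr
    rw [Measure.prod_apply_symm hC'm, Measure.prod_apply_symm hC'm]
    calc _ ≤ ∫⁻ y, (Measure.pi (fun i : Fin n => P.map (Z i)) ((fun x => (x, y)) ⁻¹' C') +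
          ∑ k ∈ Finset.range n, b k) ∂(P.map (Z n)) :=
          lintegral_mono fun y => ih _ (measurable_prodMk_right hC'm)
      _ = _ := by
          rw [lintegral_add_right _ measurable_const]
          simp

/-- Blocks of `a` consecutive values of a process: the `k`-th block starts at the time `lo k`, and
the next one starts `m` steps after its last value. The blocks can be made independent at the cost
`betaMixing P X m` for each block but the first. -/
lemma map_blocks_le_pi_add {Ω S : Type*} [MeasurableSpace Ω] [MeasurableSpace S]
    (P : Measure Ω) [IsProbabilityMeasure P] {X : ℕ → Ω → S}
    (hX : ∀ t, Measurable (X t)) {a : ℕ} (lo : ℕ → ℕ) (m : ℕ)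
    (hlo : ∀ k, lo (k + 1) = lo k + (a - 1) + m) (ha : 0 < a) (n : ℕ)
    {C : Set (Fin n → Fin a → S)} (hC : MeasurableSet C) :
    P.map (fun ω => fun (k : Fin n) (i : Fin a) => X (lo k + i) ω) C ≤
      Measure.pi (fun k : Fin n => P.map fun ω => fun i : Fin a => X (lo k + i) ω) C +
        (n - 1 : ℕ) * ENNReal.ofReal (betaMixing P X m) := by
  have hZ : ∀ k, Measurable fun ω => fun i : Fin a => X (lo k + i) ω := fun k =>
    measurable_pi_iff.2 fun i => hX _
  have key := map_le_pi_add_sum P hZ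
    (fun k => if k = 0 then 0 else ENNReal.ofReal (betaMixing P X m)) ?_ n C hC
  · refine key.trans (add_le_add le_rfl (le_of_eq ?_))
    cases n with
    | zero => simp
    | succ n => simp [Finset.sum_range_succ']
  intro k D hD
  cases k with
  | zero =>
    refine le_of_eq ?_
    rw [if_pos rfl, add_zero]
    have hpast : (fun ω => fun (k : Fin 0) (i : Fin a) => X (lo k + i) ω) =
        fun _ => (Fin.elim0 : Fin 0 → Fin a → S) := by
      ext ω k; exact k.elim0
    have hind : IndepFun (fun ω => fun (k : Fin 0) (i : Fin a) => X (lo k + i) ω)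
        (fun ω => fun i : Fin a => X (lo 0 + i) ω) P := by
      rw [hpast]; exact indepFun_const_left _ _
    rw [(indepFun_iff_map_prod_eq_prod_map_map
      (by rw [hpast]; exact aemeasurable_const) (hZ 0).aemeasurable).1 hind]
  | succ k =>
    rw [if_neg k.succ_ne_zero]
    have hmono : Monotone lo := monotone_nat_of_le_succ fun k => by rw [hlo k]; omega
    -- the blocks `0, …, k` are functions of the process up to the time `lo k + (a - 1)`
    have hidx : ∀ (l : Fin (k + 1)) (i : Fin a), lo l + i < lo k + (a - 1) + 1 := fun l i => by
      have h1 := hmono (Nat.lt_succ_iff.1 l.2)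
      have h2 := i.2
      omega
    have := map_prodMk_le_add_betaMixing P hX (lo k + (a - 1)) m
      (φ := fun x (l : Fin (k + 1)) (i : Fin a) => x ⟨lo l + i, hidx l i⟩)
      (measurable_pi_iff.2 fun l => measurable_pi_iff.2 fun i => measurable_pi_apply _)
      (ψ := fun x (i : Fin a) => x i)
      (measurable_pi_iff.2 fun i => measurable_pi_apply _) hD
    simpa only [← hlo k] using this

/-! ### Stationarity of the data -/

/-- The marginals of a Markov chain started from an invariant distribution. -/
lemma IsMarkovChain.map_eq_of_invariant {Ω S : Type*} [MeasurableSpace Ω] [MeasurableSpace S]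
    {P : Measure Ω} [IsProbabilityMeasure P] {κ : Kernel S S} [IsMarkovKernel κ] {X : ℕ → Ω → S}
    (hX : ∀ t, Measurable (X t)) (h : IsMarkovChain P κ X) {π : Measure S}
    (hκ : κ.Invariant π) (h0 : P.map (X 0) = π) (t : ℕ) : P.map (X t) = π := by
  induction t with
  | zero => exact h0
  | succ t ih =>
    have hp : Measurable fun ω => (fun i : Fin (t + 1) => X i ω) :=
      measurable_pi_iff.2 fun i => hX i
    have h1 : P.map (X (t + 1)) =
        (P.map (fun ω => ((fun i : Fin (t + 1) => X i ω), X (t + 1) ω))).snd := by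
      rw [Measure.snd, Measure.map_map measurable_snd (hp.prodMk (hX _))]
      rfl
    have h2 : (P.map fun ω => fun i : Fin (t + 1) => X i ω).map (fun x => x (Fin.last t)) = π := by
      rw [Measure.map_map (measurable_pi_apply _) hp]
      exact ih
    have := Measure.isProbabilityMeasure_map (μ := P) hp.aemeasurable
    rw [h1, h t, Measure.snd_compProd]
    ext s hs
    rw [Measure.bind_apply hs (Kernel.aemeasurable _)]
    simp only [Kernel.comap_apply]
    rw [← lintegral_map (f := fun x => κ x s) (κ.measurable_coe hs) (measurable_pi_apply _), h2,
      ← Measure.bind_apply hs (Kernel.aemeasurable _), hκ.def]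

/-! ### Uniform deviations of a mixing process -/

/-- The points of a sample of size `T` that lie in the blocks with index of parity `p`, when the
sample is cut into consecutive blocks of length `a`. -/
def parityPoints (T a p : ℕ) : Finset (Fin T) :=
  Finset.univ.filter fun t : Fin T => (t : ℕ) / a % 2 = p

/-- The uniform deviation inequality for every other block of length `a` of a mixing process: the
blocks with index of parity `p` are `a + 1` steps apart, so they may be treated as independent. -/
theorem exists_parity_deviation_le {Ω S : Type*} [MeasurableSpace Ω] [MeasurableSpace S]
    (P : Measure Ω) [IsProbabilityMeasure P] {X : ℕ → Ω → S} (hX : ∀ t, Measurable (X t))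
    {π : Measure S} (hπ : ∀ t, P.map (X t) = π) {r : ℝ≥0} {F : Set (S → ℝ)} {T n k a : ℕ}
    {K c h θ θ' : ℝ} (hK : 0 < K) (hn : 0 < n) (ha : 0 < a) (hT : T ≤ n * (2 * a))
    (hFm : ∀ f ∈ F, Measurable f) (hF : ∀ f ∈ F, ∀ x, f x ∈ Set.Icc (-K) 0)
    (hcl : IsMeasurableClass F) (hk : coveringNumberL1 r F T ≤ k)
    (hh : 0 < h) (hcheb : 2 * (n * (a * K) ^ 2) ≤ h ^ 2) (hc : c = 2 * θ' + h)
    (hθ : 0 ≤ θ) (hθ' : θ + T * r < θ') (p : ℕ) :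
    P {ω | ∃ f ∈ F, c < |∑ t ∈ parityPoints T a p, (f (X t ω) - ∫ x, f x ∂π)|} ≤
      8 * k * ENNReal.ofReal (Real.exp (-(θ ^ 2 / (2 * (n * (a * K) ^ 2))))) +
        (n - 1 : ℕ) * ENNReal.ofReal (betaMixing P X (a + 1)) := by
  classical
  set lo : ℕ → ℕ := fun k => (2 * k + p) * a with hlo
  have hlo' : ∀ k, lo (k + 1) = lo k + (a - 1) + (a + 1) := fun k => by
    simp only [hlo]
    have : a - 1 + (a + 1) = 2 * a := by omega
    rw [add_assoc, this]
    ring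
  set j : Fin T → Fin n := fun t => ⟨t / (2 * a),
    Nat.div_lt_of_lt_mul ((t.2.trans_le hT).trans_eq (mul_comm _ _))⟩ with hj
  set e : Fin T → (Fin a → S) → S := fun t y => y ⟨t % a, Nat.mod_lt _ ha⟩ with he
  set O : Finset (Fin T) := parityPoints T a p with hO
  set μ : Fin n → Measure (Fin a → S) := fun k => P.map fun ω => fun i : Fin a => X (lo k + i) ω
    with hμ
  have hZ : ∀ k, Measurable fun ω => fun i : Fin a => X (lo k + i) ω := fun k =>
    measurable_pi_iff.2 fun i => hX _
  have hμp : ∀ k, IsProbabilityMeasure (μ k) := fun k =>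
    Measure.isProbabilityMeasure_map (hZ k).aemeasurable
  have hem : ∀ t, Measurable (e t) := fun t => measurable_pi_apply _
  have hidx : ∀ t ∈ O, lo (j t) + (t : ℕ) % a = t := fun t ht => by
    have h1 : (t : ℕ) / a % 2 = p := (Finset.mem_filter.1 ht).2
    have h2 : (t : ℕ) / (2 * a) = (t : ℕ) / a / 2 := by
      rw [Nat.div_div_eq_div_mul, mul_comm]
    have h3 : 2 * ((t : ℕ) / (2 * a)) + p = (t : ℕ) / a := by omega
    change (2 * ((t : ℕ) / (2 * a)) + p) * a + (t : ℕ) % a = t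
    rw [h3]
    exact Nat.div_add_mod' _ _
  have hcard : ∀ i, (O.filter fun t => j t = i).card ≤ a := fun i => by
    have : (O.filter fun t => j t = i).card ≤ (Finset.range a).card := by
      refine Finset.card_le_card_of_injOn (fun t => (t : ℕ) % a)
        (fun t _ => Finset.mem_coe.2 (Finset.mem_range.2 (Nat.mod_lt _ ha))) ?_
      intro t ht t' ht' (htt' : (t : ℕ) % a = (t' : ℕ) % a)
      obtain ⟨h1, h2⟩ := Finset.mem_filter.1 (Finset.mem_coe.1 ht)
      obtain ⟨h1', h2'⟩ := Finset.mem_filter.1 (Finset.mem_coe.1 ht')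
      have h3 := hidx t h1
      have h4 := hidx t' h1'
      rw [h2'] at h4
      rw [h2, htt', h4] at h3
      exact (Fin.ext h3).symm
    simpa using this
  have hmean : ∀ f ∈ F, ∀ t ∈ O, ∫ y, f (e t y) ∂(μ (j t)) = ∫ x, f x ∂π := fun f hf t ht => by
    have h1 : ∫ y, f (e t y) ∂(μ (j t)) = ∫ ω, f (e t fun i => X (lo (j t) + i) ω) ∂P :=
      integral_map (hZ _).aemeasurable ((hFm f hf).comp (hem t)).aestronglyMeasurable
    rw [h1, ← hπ t,
      integral_map (hX t).aemeasurable (hFm f hf).aestronglyMeasurable]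
    simp only [he, hidx t ht]
  set C := {z : Fin n → Fin a → S | ∃ f ∈ F,
    c < |∑ t ∈ O, (f (e t (z (j t))) - ∫ x, f x ∂π)|} with hC
  have key : Measure.pi μ C ≤
      8 * k * ENNReal.ofReal (Real.exp (-(θ ^ 2 / (2 * (n * (a * K) ^ 2))))) :=
    pi_exists_deviation_le hK hn ha μ hFm hF hcl hem j O hcard hmean hk hh hcheb hc hθ hθ'
  have hdec := map_blocks_le_pi_add P hX lo (a + 1) hlo' ha n
    (measurableSet_toMeasurable (Measure.pi μ) C)
  rw [measure_toMeasurable] at hdec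
  have hblocks : Measurable fun ω => fun (k : Fin n) (i : Fin a) => X (lo k + i) ω :=
    measurable_pi_iff.2 fun k => hZ k
  have hpre := Measure.le_map_apply (μ := P) hblocks.aemeasurable (toMeasurable (Measure.pi μ) C)
  refine le_trans (measure_mono ?_) (hpre.trans (hdec.trans (by gcongr)))
  rintro ω ⟨f, hf, hω⟩
  refine subset_toMeasurable _ _ ⟨f, hf, hω.trans_le (le_of_eq ?_)⟩
  congr 1
  refine Finset.sum_congr rfl fun t ht => ?_
  simp only [he, hidx t ht]

/-- The uniform deviation inequality for a mixing process, from the blocks of both parities. -/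
theorem exists_sum_deviation_le {Ω S : Type*} [MeasurableSpace Ω] [MeasurableSpace S]
    (P : Measure Ω) [IsProbabilityMeasure P] {X : ℕ → Ω → S} (hX : ∀ t, Measurable (X t))
    {π : Measure S} (hπ : ∀ t, P.map (X t) = π) {r : ℝ≥0} {F : Set (S → ℝ)} {T n k a : ℕ}
    {K c h θ θ' : ℝ} (hK : 0 < K) (hn : 0 < n) (ha : 0 < a) (hT : T ≤ n * (2 * a))
    (hFm : ∀ f ∈ F, Measurable f) (hF : ∀ f ∈ F, ∀ x, f x ∈ Set.Icc (-K) 0)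
    (hcl : IsMeasurableClass F) (hk : coveringNumberL1 r F T ≤ k)
    (hh : 0 < h) (hcheb : 2 * (n * (a * K) ^ 2) ≤ h ^ 2) (hc : c = 2 * θ' + h)
    (hθ : 0 ≤ θ) (hθ' : θ + T * r < θ') :
    P {ω | ∃ f ∈ F, 2 * c < |∑ t : Fin T, (f (X t ω) - ∫ x, f x ∂π)|} ≤
      16 * k * ENNReal.ofReal (Real.exp (-(θ ^ 2 / (2 * (n * (a * K) ^ 2))))) +
        2 * ((n - 1 : ℕ) * ENNReal.ofReal (betaMixing P X (a + 1))) := by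
  have key := exists_parity_deviation_le P hX hπ hK hn ha hT hFm hF hcl hk hh hcheb hc hθ hθ'
  have hsub : {ω | ∃ f ∈ F, 2 * c < |∑ t : Fin T, (f (X t ω) - ∫ x, f x ∂π)|} ⊆
      {ω | ∃ f ∈ F, c < |∑ t ∈ parityPoints T a 0, (f (X t ω) - ∫ x, f x ∂π)|} ∪
      {ω | ∃ f ∈ F, c < |∑ t ∈ parityPoints T a 1, (f (X t ω) - ∫ x, f x ∂π)|} := by
    rintro ω ⟨f, hf, hω⟩
    have hsplit : ∑ t : Fin T, (f (X t ω) - ∫ x, f x ∂π) =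
        ∑ t ∈ parityPoints T a 0, (f (X t ω) - ∫ x, f x ∂π) +
          ∑ t ∈ parityPoints T a 1, (f (X t ω) - ∫ x, f x ∂π) := by
      rw [← Finset.sum_filter_add_sum_filter_not Finset.univ
        (fun t : Fin T => (t : ℕ) / a % 2 = 0)]
      simp only [Nat.mod_two_ne_zero, parityPoints]
    rw [hsplit] at hω
    have := abs_add_le (∑ t ∈ parityPoints T a 0, (f (X t ω) - ∫ x, f x ∂π))
      (∑ t ∈ parityPoints T a 1, (f (X t ω) - ∫ x, f x ∂π))
    by_contra hcon
    rw [Set.mem_union, not_or] at hcon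
    have h1 := not_lt.1 fun hlt => hcon.1 ⟨f, hf, hlt⟩
    have h2 := not_lt.1 fun hlt => hcon.2 ⟨f, hf, hlt⟩
    linarith
  refine (measure_mono hsub).trans ((measure_union_le _ _).trans
    ((add_le_add (key 0) (key 1)).trans (le_of_eq ?_)))
  ring

/-! ### The choice of the block length -/

/-- The arithmetic of the block length. Here `w = (ε / K) ^ 2`, there are `n` blocks of each parity,
`τ` is the ratio of the sample size and the block length, and `M` is the number in the exponent of
the bound. As soon as the bound is not trivial, `w * M` is large, and there are enough blocks for
Chebyshev's inequality and for the exponent. -/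
lemma block_arithmetic {w τ n M : ℝ} (hw : w ≤ 4) (hw0 : 0 < w) (hn0 : 0 ≤ n) (hn : n ≤ τ / 2 + 1)
    (hM : M ≤ τ + 1) (hbig : 345 ≤ w * M) :
    512 * n ≤ τ ^ 2 * w ∧ 64 * (n * M) ≤ 81 * τ ^ 2 := by
  have h1 : 345 ≤ w * (τ + 1) := hbig.trans (by gcongr)
  have hτ : 80 ≤ τ := by nlinarith
  constructor
  · have h2 : τ ^ 2 * 345 ≤ τ ^ 2 * w * (τ + 1) := by nlinarith [sq_nonneg τ]
    have h3 : 512 * n * (τ + 1) ≤ τ ^ 2 * w * (τ + 1) := by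
      refine le_trans ?_ h2
      nlinarith
    exact le_of_mul_le_mul_right h3 (by linarith)
  · have h2 : n * M ≤ (τ / 2 + 1) * (τ + 1) := by
      calc n * M ≤ n * (τ + 1) := by gcongr
        _ ≤ _ := by gcongr
    nlinarith

/-- The uniform deviation inequality for an algebraically mixing process, with blocks of length
`⌈T ^ (1 / (1 + s))⌉`. -/
theorem exists_deviation_le_of_algebraic_mixing {Ω S : Type*} [MeasurableSpace Ω]
    [MeasurableSpace S] (P : Measure Ω) [IsProbabilityMeasure P] {X : ℕ → Ω → S}
    (hX : ∀ t, Measurable (X t)) {π : Measure S} (hπ : ∀ t, P.map (X t) = π)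
    {F : Set (S → ℝ)} (hFne : F.Nonempty) {K ε s β₀ γ : ℝ} (hK : 0 < K) (hε : 0 < ε)
    (hFm : ∀ f ∈ F, Measurable f) (hF : ∀ f ∈ F, ∀ x, f x ∈ Set.Icc (-K) 0)
    (hcl : IsMeasurableClass F) (hβ₀ : 0 ≤ β₀) (hγ : 0 ≤ γ) (hs : 0 < s)
    (hmix : ∀ m : ℕ, 1 ≤ m → betaMixing P X m ≤ β₀ * (m : ℝ) ^ (-γ)) {T : ℕ} (hT : 1 ≤ T) :
    P {ω | ∃ f ∈ F, 31 / 32 * ε <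
        |1 / (T : ℝ) * ∑ t ∈ Finset.range T, f (X t ω) - ∫ x, f x ∂π|} ≤
      16 * (coveringNumberL1 (ε / 16).toNNReal F T : ℝ≥0∞) *
        ENNReal.ofReal (Real.exp (-(ε ^ 2 / (128 * K ^ 2) * (⌈(T : ℝ) ^ (s / (1 + s)) / 2⌉₊ : ℝ)))) +
        ENNReal.ofReal (β₀ * (T : ℝ) ^ ((s - γ) / (1 + s))) := by
  have hT0 : (0 : ℝ) < T := by exact_mod_cast hT
  set ρ : ℝ := (T : ℝ) ^ (1 / (1 + s)) with hρ
  set m : ℝ := (T : ℝ) ^ (s / (1 + s)) with hm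
  have hρ1 : 1 ≤ ρ := Real.one_le_rpow (by exact_mod_cast hT) (by positivity)
  have hm0 : 0 < m := Real.rpow_pos_of_pos hT0 _
  have hρm : ρ * m = T := by
    rw [hρ, hm, ← Real.rpow_add hT0, ← add_div, div_self (by linarith), Real.rpow_one]
  set M : ℝ := (⌈m / 2⌉₊ : ℝ) with hM
  set a : ℕ := ⌈ρ⌉₊ with ha
  have hρa : ρ ≤ a := Nat.le_ceil _
  have ha0 : (0 : ℝ) < a := by linarith
  have haρ : (a : ℝ) ≤ 2 * ρ := by
    have := Nat.ceil_lt_add_one (show 0 ≤ ρ by linarith)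
    linarith
  have ha0' : 0 < a := by exact_mod_cast ha0
  set τ : ℝ := T / a with hτ
  have hτ0 : 0 < τ := by positivity
  have hτT : (T : ℝ) = τ * a := by rw [hτ]; field_simp
  have hmτ : m / 2 ≤ τ := by
    rw [hτ, le_div_iff₀ ha0, ← hρm]
    nlinarith
  set n : ℕ := ⌈τ / 2⌉₊ with hn
  have hn0 : 0 < n := Nat.ceil_pos.2 (by positivity)
  have hn0' : (0 : ℝ) < n := by exact_mod_cast hn0
  have hnτ : (n : ℝ) < τ / 2 + 1 := Nat.ceil_lt_add_one (by positivity)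
  have hτn : τ / 2 ≤ n := Nat.le_ceil _
  have hTn : T ≤ n * (2 * a) := by
    have : (T : ℝ) ≤ n * (2 * a) := by rw [hτT]; nlinarith
    exact_mod_cast this
  -- the total mixing cost: the blocks have length at least `ρ`
  have hmixing : 2 * (((n - 1 : ℕ) : ℝ≥0∞) * ENNReal.ofReal (betaMixing P X (a + 1))) ≤
      ENNReal.ofReal (β₀ * (T : ℝ) ^ ((s - γ) / (1 + s))) := by
    have h1 : betaMixing P X (a + 1) ≤ β₀ * ρ ^ (-γ) := by
      refine (hmix (a + 1) (by omega)).trans ?_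
      refine mul_le_mul_of_nonneg_left ?_ hβ₀
      refine Real.rpow_le_rpow_of_nonpos (by linarith) ?_ (by linarith)
      push_cast
      linarith
    have h2 : (2 * (n - 1 : ℕ) : ℝ) ≤ m := by
      rw [Nat.cast_sub hn0, Nat.cast_one]
      have : τ ≤ m := by
        rw [hτ, div_le_iff₀ ha0, ← hρm, mul_comm]
        gcongr
      linarith
    have h3 : m * ρ ^ (-γ) = (T : ℝ) ^ ((s - γ) / (1 + s)) := by
      rw [hρ, hm, ← Real.rpow_mul hT0.le, ← Real.rpow_add hT0]
      congr 1
      ring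
    have h4 : 0 ≤ β₀ * ρ ^ (-γ) := mul_nonneg hβ₀ (Real.rpow_nonneg (by linarith) _)
    calc 2 * (((n - 1 : ℕ) : ℝ≥0∞) * ENNReal.ofReal (betaMixing P X (a + 1)))
        ≤ 2 * (((n - 1 : ℕ) : ℝ≥0∞) * ENNReal.ofReal (β₀ * ρ ^ (-γ))) := by gcongr
      _ = ENNReal.ofReal ((2 * (n - 1 : ℕ)) * (β₀ * ρ ^ (-γ))) := by
          rw [ENNReal.ofReal_mul (p := 2 * ((n - 1 : ℕ) : ℝ)) (by positivity),
            ENNReal.ofReal_mul (p := (2 : ℝ)) (by norm_num), ENNReal.ofReal_natCast,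
            ENNReal.ofReal_ofNat, mul_assoc]
      _ ≤ ENNReal.ofReal (β₀ * (T : ℝ) ^ ((s - γ) / (1 + s))) := by
          refine ENNReal.ofReal_le_ofReal ?_
          rw [← h3]
          calc _ ≤ m * (β₀ * ρ ^ (-γ)) := by gcongr
            _ = _ := by ring
  rcases eq_or_ne (coveringNumberL1 (ε / 16).toNNReal F T) ⊤ with htop | htop
  · rw [htop, ENat.toENNReal_top, ENNReal.mul_top (by norm_num), ENNReal.top_mul]
    · simp
    · simpa using Real.exp_pos _
  obtain ⟨k, hk⟩ := ENat.ne_top_iff_exists.1 htop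
  obtain ⟨ω₀⟩ : Nonempty Ω := nonempty_of_isProbabilityMeasure P
  have hk1 : 1 ≤ k := by
    have h1 : 0 < coveringNumberL1 (ε / 16).toNNReal F T :=
      (Metric.coveringNumber_pos_iff.2 (hFne.image _)).trans_le
        (le_iSup (fun x : Fin T → S => Metric.coveringNumber (T * (ε / 16).toNNReal)
          ((fun f : S → ℝ => (WithLp.toLp 1 fun t => f (x t) : PiLp 1 fun _ : Fin T => ℝ)) '' F))
          fun t => X t ω₀)
    rw [← hk] at h1
    exact_mod_cast h1
  set E : ℝ := ε ^ 2 / (128 * K ^ 2) * M with hE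
  rw [← hk, ENat.toENNReal_coe]
  -- the bound is trivial if it is at least `1`
  rcases le_or_gt 1 (16 * Real.exp (-E)) with htriv | hlt
  · refine prob_le_one.trans (le_add_right ?_)
    calc (1 : ℝ≥0∞) = ENNReal.ofReal 1 := by simp
      _ ≤ ENNReal.ofReal (16 * Real.exp (-E)) := ENNReal.ofReal_le_ofReal htriv
      _ = 16 * 1 * ENNReal.ofReal (Real.exp (-E)) := by
          rw [ENNReal.ofReal_mul (by norm_num)]; simp
      _ ≤ _ := by gcongr; exact_mod_cast hk1
  rcases Set.eq_empty_or_nonempty {ω | ∃ f ∈ F, 31 / 32 * ε <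
      |1 / (T : ℝ) * ∑ t ∈ Finset.range T, f (X t ω) - ∫ x, f x ∂π|} with hempty | ⟨ω, f, hf, hω⟩
  · rw [hempty]; simp
  have hπp : IsProbabilityMeasure π := hπ 0 ▸ Measure.isProbabilityMeasure_map (hX 0).aemeasurable
  have hεK : ε ≤ 2 * K := by
    have hint : Integrable f π := (memLp_of_bounded (Filter.Eventually.of_forall (hF f hf))
      (hFm f hf).aestronglyMeasurable 1).integrable le_rfl
    have h1 : -K ≤ ∫ x, f x ∂π := by
      have := integral_mono (integrable_const (-K)) hint fun x => (hF f hf x).1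
      simpa using this
    have h2 : ∫ x, f x ∂π ≤ 0 := integral_nonpos fun x => (hF f hf x).2
    have h3 : 1 / (T : ℝ) * ∑ t ∈ Finset.range T, f (X t ω) ≤ 0 :=
      mul_nonpos_of_nonneg_of_nonpos (by positivity)
        (Finset.sum_nonpos fun t _ => (hF f hf _).2)
    have h4 : -K ≤ 1 / (T : ℝ) * ∑ t ∈ Finset.range T, f (X t ω) := by
      have := Finset.sum_le_sum fun t (_ : t ∈ Finset.range T) => (hF f hf (X t ω)).1
      rw [Finset.sum_const, Finset.card_range, nsmul_eq_mul] at this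
      rw [one_div, inv_mul_eq_div, le_div_iff₀ hT0]
      linarith
    have h5 := hω.trans_le (abs_le.2 ⟨by linarith, by linarith⟩ : _ ≤ K)
    linarith
  obtain ⟨hb1, hb2⟩ : 512 * n ≤ τ ^ 2 * (ε / K) ^ 2 ∧ 64 * (n * M) ≤ 81 * τ ^ 2 := by
    refine block_arithmetic ?_ (by positivity) hn0'.le hnτ.le ?_ ?_
    · have : ε / K ≤ 2 := (div_le_iff₀ hK).2 hεK
      have h0 : 0 ≤ ε / K := by positivity
      nlinarith
    · have := Nat.ceil_lt_add_one (show 0 ≤ m / 2 by positivity)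
      linarith
    · -- `16 * exp (-E) < 1` gives `E > log 16 = 4 * log 2`
      have h1 : Real.log 16 < E := by
        rw [Real.log_lt_iff_lt_exp (by norm_num)]
        rw [Real.exp_neg, ← div_eq_mul_inv, div_lt_one (Real.exp_pos _)] at hlt
        exact hlt
      have h2 : Real.log 16 = 4 * Real.log 2 := by
        rw [show (16 : ℝ) = 2 ^ 4 by norm_num, Real.log_pow]; norm_num
      have h3 : (ε / K) ^ 2 * M = 128 * E := by rw [hE]; field_simp
      have := Real.log_two_gt_d9
      rw [h3]
      linarith
  have hεw : ε ^ 2 = (ε / K) ^ 2 * K ^ 2 := by field_simp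
  have key := exists_sum_deviation_le P hX hπ (r := (ε / 16).toNNReal) (k := k)
    (c := 31 / 64 * (T * ε)) (h := 4 / 64 * (T * ε)) (θ := 18 / 128 * (T * ε))
    (θ' := 27 / 128 * (T * ε)) hK hn0 ha0' hTn hFm hF hcl hk.ge (by positivity) ?_ (by ring)
    (by positivity) ?_
  · refine le_trans (measure_mono ?_) (key.trans (add_le_add ?_ hmixing))
    · rintro ω ⟨f, hf, hω⟩
      refine ⟨f, hf, ?_⟩
      have h1 : ∑ t : Fin T, (f (X t ω) - ∫ x, f x ∂π) =
          T * (1 / (T : ℝ) * ∑ t ∈ Finset.range T, f (X t ω) - ∫ x, f x ∂π) := by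
        rw [Fin.sum_univ_eq_sum_range (fun t => f (X t ω) - ∫ x, f x ∂π), Finset.sum_sub_distrib]
        simp only [Finset.sum_const, Finset.card_range, nsmul_eq_mul]
        field_simp
      rw [h1, abs_mul, abs_of_pos hT0]
      nlinarith
    · gcongr
      rw [le_div_iff₀ (by positivity)]
      have h1 : E * (2 * (n * (a * K) ^ 2)) =
          64 * (n * M) * ((ε / K) ^ 2 * K ^ 2 * a ^ 2) / 4096 := by
        rw [hE]; field_simp; ring
      have h2 : (18 / 128 * (T * ε)) ^ 2 =
          81 * τ ^ 2 * ((ε / K) ^ 2 * K ^ 2 * a ^ 2) / 4096 := by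
        rw [← hεw, hτT]; ring
      rw [h1, h2]
      gcongr
  · have h1 : (4 / 64 * (T * ε)) ^ 2 = τ ^ 2 * (ε / K) ^ 2 * (a * K) ^ 2 / 256 := by
      have : τ ^ 2 * (ε / K) ^ 2 * (a * K) ^ 2 = τ ^ 2 * ((ε / K) ^ 2 * K ^ 2) * a ^ 2 := by ring
      rw [this, ← hεw, hτT]; ring
    rw [h1]
    have := mul_le_mul_of_nonneg_right hb1 (sq_nonneg ((a : ℝ) * K))
    linarith
  · rw [Real.coe_toNNReal _ (by positivity)]
    have : 0 < T * ε := by positivity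
    linarith

/-! ### Mechanism learning with sample sharing -/

namespace GTML

variable {A B U H Ω : Type*} [MeasurableSpace B] [MeasurableSpace U] [MeasurableSpace H]
  [Finite B] [MeasurableSingletonClass B] [Finite H] [MeasurableSingletonClass H]

lemma isMarkovKernel_kernel (G : GTML A B U H) (a : A) : IsMarkovKernel (G.kernel a) := by
  have := G.isProbabilityMeasure_userLaw
  have : IsMarkovKernel (Kernel.ofFunOfCountable fun y : H × B => (G.model y.1 y.2).toMeasure) :=
    ⟨fun y => PMF.toMeasure.isProbabilityMeasure _⟩
  unfold kernel
  infer_instance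

variable [MeasurableSpace Ω]

lemma IsStationaryData.measurable_prodMk {G : GTML A B U H} {P : Measure Ω} {u : ℕ → Ω → U}
    {b : A → ℕ → Ω → B} {π : A → Measure (B × U)} (h : G.IsStationaryData P u b π) (a : A) (t : ℕ) :
    Measurable fun ω => (b a t ω, u t ω) :=
  (h.measurable_behavior a t).prodMk (h.measurable_user t)

lemma IsStationaryData.map_prodMk {G : GTML A B U H} {P : Measure Ω} [IsProbabilityMeasure P]
    {u : ℕ → Ω → U} {b : A → ℕ → Ω → B} {π : A → Measure (B × U)}
    (h : G.IsStationaryData P u b π) (a : A) (t : ℕ) :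
    P.map (fun ω => (b a t ω, u t ω)) = π a :=
  have := G.isMarkovKernel_kernel a
  (h.markov a).map_eq_of_invariant (h.measurable_prodMk a) (h.invariant a) (h.initial a) t

lemma IsStationaryData.isProbabilityMeasure {G : GTML A B U H} {P : Measure Ω}
    [IsProbabilityMeasure P] {u : ℕ → Ω → U} {b : A → ℕ → Ω → B} {π : A → Measure (B × U)}
    (h : G.IsStationaryData P u b π) (a : A) : IsProbabilityMeasure (π a) :=
  h.map_prodMk a 0 ▸ Measure.isProbabilityMeasure_map (h.measurable_prodMk a 0).aemeasurable

/-- A large uniform deviation under sample sharing is due to one of the cells, and to the data of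
its centre: sharing costs at most `K * α * δ`. The factor `31 / 32` replaces the supremum by a
witness. -/
lemma exists_cell_of_le_uniformDeviation [PseudoMetricSpace A] {G : GTML A B U H} {P : Measure Ω}
    [IsProbabilityMeasure P] {u : ℕ → Ω → U} {b : A → ℕ → Ω → B} {π : A → Measure (B × U)}
    (hdata : G.IsStationaryData P u b π) {α ε δ : ℝ} (hα : 0 ≤ α)
    (hLip : ∀ a a', tvDist (π a) (π a') ≤ α * dist a a') (hδ : 0 < δ) (hδε : G.K * α * δ < ε)
    {N : ℕ} {g : Fin N → A} {cell : A → Fin N} (hcover : IsMinimalCoverPartition δ g cell)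
    {T : ℕ} {ω : Ω} (hω : ε ≤ G.uniformDeviation π u b (fun a => g (cell a)) T ω) :
    ∃ i, ∃ f ∈ G.lossClass (cell ⁻¹' {i}), 31 / 32 * (ε - G.K * α * δ) <
      |1 / (T : ℝ) * ∑ t ∈ Finset.range T, f (b (g i) t ω, u t ω) - ∫ x, f x ∂(π (g i))| := by
  have hK := G.K_pos
  have hKαδ : 0 ≤ G.K * α * δ := by positivity
  obtain ⟨a, ha⟩ : ∃ a, ε - (ε - G.K * α * δ) / 32 <
      |G.empiricalRisk u b (fun a => g (cell a)) T a ω - G.risk π a| := by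
    by_contra! hcon
    have := hω.trans (Real.iSup_le hcon (by linarith))
    linarith
  refine ⟨cell a, fun x => G.loss a x.1 x.2, ⟨a, rfl, rfl⟩, ?_⟩
  have h1 := hdata.isProbabilityMeasure a
  have h2 := hdata.isProbabilityMeasure (g (cell a))
  have h3 : |∫ x, G.loss a x.1 x.2 ∂(π (g (cell a))) - ∫ x, G.loss a x.1 x.2 ∂(π a)| ≤
      G.K * α * δ := by
    refine (abs_integral_sub_le_tvDist _ _ hK.le (G.measurable_loss a)
      fun x => G.loss_mem a x.1 x.2).trans ?_
    rw [mul_assoc]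
    gcongr
    refine (hLip _ _).trans ?_
    gcongr
    rw [dist_comm]
    exact hcover.dist_le a
  have h4 := abs_sub_le (G.empiricalRisk u b (fun a => g (cell a)) T a ω)
    (∫ x, G.loss a x.1 x.2 ∂(π (g (cell a)))) (G.risk π a)
  have h5 : |G.empiricalRisk u b (fun a => g (cell a)) T a ω -
      ∫ x, G.loss a x.1 x.2 ∂(π (g (cell a)))| =
      |1 / (T : ℝ) * ∑ t ∈ Finset.range T, G.loss a (b (g (cell a)) t ω) (u t ω) -
        ∫ x, G.loss a x.1 x.2 ∂(π (g (cell a)))| := rfl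
  have h6 : |∫ x, G.loss a x.1 x.2 ∂(π (g (cell a))) - G.risk π a| ≤ G.K * α * δ := h3
  rw [h5] at h4
  linarith

end GTML

theorem theorem4 {A B U H Ω : Type*} [PseudoMetricSpace A]
    [Finite B] [MeasurableSpace B] [MeasurableSingletonClass B] [MeasurableSpace U]
    [Finite H] [MeasurableSpace H] [MeasurableSingletonClass H]
    [MeasurableSpace Ω] (P : Measure Ω) [IsProbabilityMeasure P]
    (G : GTML A B U H) (u : ℕ → Ω → U) (b : A → ℕ → Ω → B) (π : A → Measure (B × U))
    (hdata : G.IsStationaryData P u b π)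
    -- the mechanism-to-stationary-distribution map is Lipschitz
    (α : ℝ) (hα : 0 ≤ α) (hLip : ∀ a a', tvDist (π a) (π a') ≤ α * dist a a')
    -- algebraic mixing
    (β₀ γ : ℝ) (hβ₀ : 0 ≤ β₀) (hγ : 0 ≤ γ)
    (hmix : ∀ (a : A) (m : ℕ), 1 ≤ m →
      betaMixing P (fun t ω => (b a t ω, u t ω)) m ≤ β₀ * (m : ℝ) ^ (-γ))
    -- the parameters
    (ε δ s : ℝ) (hε : 0 < ε) (hδ : 0 < δ) (hδε : δ * (G.K * α) < ε) (hs : 0 < s) (hsγ : s < γ)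
    -- the cover, its cells, and the sample sharing
    {N : ℕ} (g : Fin N → A) (cell : A → Fin N) (hcover : IsMinimalCoverPartition δ g cell)
    (hmeas : ∀ i, IsMeasurableClass (G.lossClass (cell ⁻¹' {i}))) :
    (∀ T : ℕ, 1 ≤ T →
      -- the bound
      P {ω | ε ≤ G.uniformDeviation π u b (fun a => g (cell a)) T ω} ≤
        (N : ℝ≥0∞) * ⨆ i : Fin N,
          (16 * (coveringNumberL1 ((ε - G.K * α * δ) / 16).toNNReal
              (G.lossClass (cell ⁻¹' {i})) T : ℝ≥0∞) *
            ENNReal.ofReal (Real.exp (-((ε - δ * α * G.K) ^ 2 / (128 * G.K ^ 2) *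
              (⌈(T : ℝ) ^ (s / (1 + s)) / 2⌉₊ : ℝ)))) +
            ENNReal.ofReal (β₀ * (⌈(T : ℝ) ^ ((s - γ) / (1 + s))⌉₊ : ℝ))) ∧
      -- the bound with the decaying mixing term
      P {ω | ε ≤ G.uniformDeviation π u b (fun a => g (cell a)) T ω} ≤
        (N : ℝ≥0∞) * ⨆ i : Fin N,
          (16 * (coveringNumberL1 ((ε - G.K * α * δ) / 16).toNNReal
              (G.lossClass (cell ⁻¹' {i})) T : ℝ≥0∞) *
            ENNReal.ofReal (Real.exp (-((ε - δ * α * G.K) ^ 2 / (128 * G.K ^ 2) *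
              (⌈(T : ℝ) ^ (s / (1 + s)) / 2⌉₊ : ℝ)))) +
            ENNReal.ofReal (β₀ * (T : ℝ) ^ ((s - γ) / (1 + s))))) ∧
    -- the rate
    (∃ C c : ℝ, 0 < C ∧ 0 < c ∧ ∀ T : ℕ, 1 ≤ T →
      P {ω | ε ≤ G.uniformDeviation π u b (fun a => g (cell a)) T ω} ≤
        ENNReal.ofReal C * ((N : ℝ≥0∞) *
          ((⨆ i : Fin N, (coveringNumberL1 ((ε - G.K * α * δ) / 16).toNNReal
              (G.lossClass (cell ⁻¹' {i})) T : ℝ≥0∞)) *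
            ENNReal.ofReal (Real.exp (-(c * (T : ℝ) ^ (s / (1 + s))))) +
            ENNReal.ofReal ((T : ℝ) ^ ((s - γ) / (1 + s)))))) := by
  have hK := G.K_pos
  have hδε' : G.K * α * δ < ε := by linarith
  set ε' : ℝ := ε - G.K * α * δ with hε'
  have hε'0 : 0 < ε' := by linarith
  have hsq : ε - δ * α * G.K = ε' := by rw [hε']; ring
  rw [hsq]
  have hmain : ∀ T : ℕ, 1 ≤ T →
      P {ω | ε ≤ G.uniformDeviation π u b (fun a => g (cell a)) T ω} ≤
        (N : ℝ≥0∞) * ⨆ i : Fin N,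
          (16 * (coveringNumberL1 (ε' / 16).toNNReal
              (G.lossClass (cell ⁻¹' {i})) T : ℝ≥0∞) *
            ENNReal.ofReal (Real.exp (-(ε' ^ 2 / (128 * G.K ^ 2) *
              (⌈(T : ℝ) ^ (s / (1 + s)) / 2⌉₊ : ℝ)))) +
            ENNReal.ofReal (β₀ * (T : ℝ) ^ ((s - γ) / (1 + s)))) := by
    intro T hT
    set Q : Fin N → ℝ≥0∞ := fun i => 16 * (coveringNumberL1 (ε' / 16).toNNReal
        (G.lossClass (cell ⁻¹' {i})) T : ℝ≥0∞) *
      ENNReal.ofReal (Real.exp (-(ε' ^ 2 / (128 * G.K ^ 2) *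
        (⌈(T : ℝ) ^ (s / (1 + s)) / 2⌉₊ : ℝ)))) +
      ENNReal.ofReal (β₀ * (T : ℝ) ^ ((s - γ) / (1 + s))) with hQ
    have hcell : ∀ i, P {ω | ∃ f ∈ G.lossClass (cell ⁻¹' {i}), 31 / 32 * ε' <
        |1 / (T : ℝ) * ∑ t ∈ Finset.range T, f (b (g i) t ω, u t ω) -
          ∫ x, f x ∂(π (g i))|} ≤ Q i := by
      intro i
      rcases Set.eq_empty_or_nonempty (G.lossClass (cell ⁻¹' {i})) with hempty | hne
      · simp [hempty]
      · refine exists_deviation_le_of_algebraic_mixing P (hdata.measurable_prodMk (g i))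
          (hdata.map_prodMk (g i)) hne hK hε'0 ?_ ?_ (hmeas i) hβ₀ hγ hs (hmix (g i)) hT
        · rintro _ ⟨a, _, rfl⟩
          exact G.measurable_loss a
        · rintro _ ⟨a, _, rfl⟩ x
          exact G.loss_mem a x.1 x.2
    calc P {ω | ε ≤ G.uniformDeviation π u b (fun a => g (cell a)) T ω}
        ≤ P (⋃ i, {ω | ∃ f ∈ G.lossClass (cell ⁻¹' {i}), 31 / 32 * ε' <
            |1 / (T : ℝ) * ∑ t ∈ Finset.range T, f (b (g i) t ω, u t ω) -
              ∫ x, f x ∂(π (g i))|}) := by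
          refine measure_mono fun ω hω => Set.mem_iUnion.2 ?_
          exact GTML.exists_cell_of_le_uniformDeviation hdata hα hLip hδ hδε' hcover hω
      _ ≤ ∑ i, P {ω | ∃ f ∈ G.lossClass (cell ⁻¹' {i}), 31 / 32 * ε' <
            |1 / (T : ℝ) * ∑ t ∈ Finset.range T, f (b (g i) t ω, u t ω) -
              ∫ x, f x ∂(π (g i))|} := measure_iUnion_fintype_le _ _
      _ ≤ ∑ _i : Fin N, ⨆ i, Q i :=
          Finset.sum_le_sum fun i _ => (hcell i).trans (le_iSup Q i)
      _ = _ := by rw [Finset.sum_const, Finset.card_univ, Fintype.card_fin, nsmul_eq_mul]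
  refine ⟨fun T hT => ⟨(hmain T hT).trans ?_, hmain T hT⟩,
    16 + β₀, ε' ^ 2 / (256 * G.K ^ 2), by positivity, by positivity, fun T hT =>
      (hmain T hT).trans ?_⟩
  · gcongr
    exact Nat.le_ceil _
  · rw [mul_left_comm]
    gcongr
    refine iSup_le fun i => ?_
    rw [mul_add]
    refine add_le_add ?_ ?_
    · rw [mul_assoc]
      refine mul_le_mul' ?_ (mul_le_mul' (le_iSup (fun i => (coveringNumberL1 (ε' / 16).toNNReal
        (G.lossClass (cell ⁻¹' {i})) T : ℝ≥0∞)) i) (ENNReal.ofReal_le_ofReal ?_))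
      · rw [← ENNReal.ofReal_ofNat]
        exact ENNReal.ofReal_le_ofReal (by linarith)
      · refine Real.exp_le_exp.2 (neg_le_neg ?_)
        have h1 : (T : ℝ) ^ (s / (1 + s)) / 2 ≤ ⌈(T : ℝ) ^ (s / (1 + s)) / 2⌉₊ := Nat.le_ceil _
        calc ε' ^ 2 / (256 * G.K ^ 2) * (T : ℝ) ^ (s / (1 + s))
            = ε' ^ 2 / (128 * G.K ^ 2) * ((T : ℝ) ^ (s / (1 + s)) / 2) := by
              field_simp; norm_num
          _ ≤ _ := by gcongr
    · rw [← ENNReal.ofReal_mul (by positivity)]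
      refine ENNReal.ofReal_le_ofReal ?_
      gcongr
      linarith
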